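/- Let $\Omega\subset\mathbb R^d$ be a bounded domain (a non-empty connected open set), let $\partial\Omega_D\subseteq\partial\Omega$ and $\partial\Omega_N:=\partial\Omega\setminus\partial\Omega_D$. Assume that $\Omega$ is regular: near each point of $\partial\Omega_N$, $\Omega$ is, in suitable Cartesian coordinates, the region below the graph of a continuous function, and near $\mathcal H^{d-1}$-almost every point of $\partial\Omega_N$ this function can be taken to be $C^1$ (for some choice of Cartesian coordinates); here $\mathcal H^{d-1}$ is the $(d-1)$-dimensional Hausdorff (surface) measure, and $\nu$ denotes the outward unit normal, which then exists $\mathcal H^{d-1}$-a.e. on $\partial\Omega_N$. No regularity is assumed on $\partial\Omega_D$. Call a function $f$ absolutely continuous (in the sense of Tonelli) if it is continuous on $\Omega\cup\partial\Omega_N$, absolutely continuous on every compact segment, contained in $\Omega$, of almost every line parallel to a coordinate axis, and if its first partial derivatives (which exist a.e. in $\Omega$) are integrable on $\Omega\cap K$ for every compact $K\subset\mathbb R^d\setminus\partial\Omega_D$. Vector and matrix fields are absolutely continuous if all of their components are. Divergences and gradients are formed with the a.e. defined partial derivatives. Let $\mathcal D(\Omega,\partial\Omega_D)$ be the set of restrictions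 to $\Omega$ of the real-valued $\zeta\in C_c^\infty(\mathbb R^d)$ whose support is disjoint from $\partial\Omega_D$. Let $1<p<\infty$ and $p'=\frac p{p-1}$. **(1.1)** Let $\mathbf Q$ be an absolutely continuous vector field and $A$ an absolutely continuous real $d\times d$ matrix field with $\nu\cdot A^T\mathbf Q\le 0$ $\mathcal H^{d-1}$-a.e. on $\partial\Omega_N$. Then for all $\zeta\in\mathcal D(\Omega,\partial\Omega_D)$ both integrands below are integrable over $\Omega$, and $$\int_\Omega |A\nabla\zeta|^p\,dx\ \ge\ \int_\Omega\left\{\operatorname{div}(A^T\mathbf Q)-(p-1)|\mathbf Q|^{p'}\right\}|\zeta|^p\,dx .$$ **(1.2)** Let $a$ and $q$ be absolutely continuous real-valued functions and $\mathbf u$ a fixed unit vector with $a\,q\,\mathbf u\cdot\nu\le 0$ $\mathcal H^{d-1}$-a.e. on $\partial\Omega_N$. Then for all $\zeta\in\mathcal D(\Omega,\partial\Omega_D)$ both integrands below are integrable over $\Omega$, and $$\int_\Omega |a\,\mathbf u\cdot\nabla\zeta|^p\,dx\ \ge\ \int_\Omega\left\{\mathbf u\cdot\nabla(aq)-(p-1)|q|^{p'}\right\}|\zeta|^p\,dx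 .$$ -/

import Mathlib

open MeasureTheory Set Filter Topology
open scoped Matrix ContDiff Gradient

/-- The `i`-th standard basis vector of `ℝ^d`. -/
noncomputable abbrev stdVec {d : ℕ} (i : Fin d) : EuclideanSpace ℝ (Fin d) :=
  EuclideanSpace.single i 1

/-- The `i`-th (classical, pointwise) partial derivative `∂f/∂x_i`. -/
noncomputable def partialDeriv {d : ℕ} (i : Fin d) (f : EuclideanSpace ℝ (Fin d) → ℝ)
    (x : EuclideanSpace ℝ (Fin d)) : ℝ :=
  lineDeriv ℝ f x (stdVec i)

/-- The divergence `∑ i, ∂V_i/∂x_i` of a vector field. -/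
noncomputable def divergence {d : ℕ}
    (V : EuclideanSpace ℝ (Fin d) → EuclideanSpace ℝ (Fin d))
    (x : EuclideanSpace ℝ (Fin d)) : ℝ :=
  ∑ i, partialDeriv i (fun y => V y i) x

/-- Matrix times vector, as a vector of Euclidean space (so that its norm is Euclidean). -/
noncomputable def matVec {d : ℕ} (M : Matrix (Fin d) (Fin d) ℝ)
    (v : EuclideanSpace ℝ (Fin d)) : EuclideanSpace ℝ (Fin d) :=
  WithLp.toLp 2 (M *ᵥ v.ofLp)

/-- The function `y ↦ ⟨e, y⟩ - g (y')`, where `y' = y - ⟨e, y⟩ e` is the component of `y`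
orthogonal to the unit vector `e`. It vanishes exactly on the graph of `g` over the
hyperplane orthogonal to `e`, and is negative exactly below that graph. -/
noncomputable def graphFun {d : ℕ} (e : EuclideanSpace ℝ (Fin d))
    (g : EuclideanSpace ℝ (Fin d) → ℝ) (y : EuclideanSpace ℝ (Fin d)) : ℝ :=
  inner ℝ e y - g (y - (inner ℝ e y : ℝ) • e)

/-- Near the boundary point `x`, the set `Ω` is the region below the graph of `g`
in the Cartesian coordinates whose last axis points along the unit vector `e`. -/
def IsBelowGraphAt {d : ℕ} (Ω : Set (EuclideanSpace ℝ (Fin d))) (x : EuclideanSpace ℝ (Fin d))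
    (e : EuclideanSpace ℝ (Fin d)) (g : EuclideanSpace ℝ (Fin d) → ℝ) : Prop :=
  x ∈ frontier Ω ∧ ‖e‖ = 1 ∧ ∀ᶠ y in 𝓝 x, (y ∈ Ω ↔ graphFun e g y < 0)

/-- `∂Ω` is of class `C` at the point `x`: near `x`, `Ω` is the region below the graph of a
continuous function. -/
def IsBoundaryOfClassCAt {d : ℕ} (Ω : Set (EuclideanSpace ℝ (Fin d)))
    (x : EuclideanSpace ℝ (Fin d)) : Prop :=
  ∃ e g, Continuous g ∧ IsBelowGraphAt Ω x e g

/-- `∂Ω` is `C¹` near `x`, and `ν` is the outward unit normal of `Ω` at `x`. -/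
def IsOutwardNormalAt {d : ℕ} (Ω : Set (EuclideanSpace ℝ (Fin d)))
    (x ν : EuclideanSpace ℝ (Fin d)) : Prop :=
  ∃ e g, ContDiff ℝ 1 g ∧ IsBelowGraphAt Ω x e g ∧
    ν = ‖∇ (graphFun e g) x‖⁻¹ • ∇ (graphFun e g) x

/-- `Ω` is a regular bounded domain, whose boundary is split into the Dirichlet part `D` and the
remaining part `∂Ω \ D`: the boundary is of class `C` on `∂Ω \ D`, and it is `C¹` near almost
every point of `∂Ω \ D` for the surface measure, i.e. the `(d-1)`-dimensional Hausdorff measure.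
(No regularity is imposed at the points of `D`.) -/
structure IsRegularDomain {d : ℕ} (Ω D : Set (EuclideanSpace ℝ (Fin d))) : Prop where
  isOpen : IsOpen Ω
  isConnected : IsConnected Ω
  isBounded : Bornology.IsBounded Ω
  subset_frontier : D ⊆ frontier Ω
  classC : ∀ x ∈ frontier Ω \ D, IsBoundaryOfClassCAt Ω x
  ae_C1 : ∀ᵐ x ∂(μH[(d : ℝ) - 1] : Measure (EuclideanSpace ℝ (Fin d))),
    x ∈ frontier Ω \ D → ∃ ν, IsOutwardNormalAt Ω x ν

/-- Absolute continuity (in the sense of Tonelli) of a function of `d` real variables on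
`Ω ∪ (∂Ω \ D)`: it is continuous there, it is absolutely continuous on every compact segment
in `Ω` of almost every line parallel to a coordinate axis, and its (almost everywhere defined)
partial derivatives are integrable away from `D`.
A line parallel to the `i`-th axis is given by one of its points; by Fubini, almost every line
is the same as almost every point. -/
structure IsAbsCont {d : ℕ} (Ω D : Set (EuclideanSpace ℝ (Fin d)))
    (f : EuclideanSpace ℝ (Fin d) → ℝ) : Prop where
  continuousOn : ContinuousOn f (closure Ω \ D)
  ae_line : ∀ i : Fin d, ∀ᵐ x : EuclideanSpace ℝ (Fin d), ∀ s t : ℝ, s ≤ t →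
    (∀ r ∈ Icc s t, x + r • stdVec i ∈ Ω) →
      AbsolutelyContinuousOnInterval (fun r : ℝ => f (x + r • stdVec i)) s t
  integrableOn : ∀ i : Fin d, ∀ K : Set (EuclideanSpace ℝ (Fin d)), IsCompact K → Disjoint K D →
    IntegrableOn (partialDeriv i f) (Ω ∩ K)

/-- Real-valued test functions: `C^∞` functions on `ℝ^d` with compact support contained in
`ℝ^d \ D`. (Only their restrictions to `Ω` matter below.) -/
def testFunctions {d : ℕ} (D : Set (EuclideanSpace ℝ (Fin d))) :
    Set (EuclideanSpace ℝ (Fin d) → ℝ) :=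
  {ζ | ContDiff ℝ ∞ ζ ∧ HasCompactSupport ζ ∧ Disjoint (tsupport ζ) D}

/-! Put `V = Aᵀ Q` in the first inequality and `V = a q u` in the second. Everything rests on a
one-sided divergence theorem, `IsRegularDomain.fluxIneq`: for `Ψ ≥ 0` of class `C¹` with compact
support off `D`, `∫ (div V) Ψ ≤ -∫ ∇Ψ · V` over `Ω`. Take `Ψ = |ζ|^p`. Since `|V · ∇ζ| ≤ N M` with
`N = |Q|`, `M = |A∇ζ|` (or their scalar analogues), Young's inequality bounds `-∇Ψ · V` pointwise by
`M^p + (p-1) N^{p'} |ζ|^p`, and this is the claim.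

No surface integral occurs in the proof of the flux inequality. For `Ψ` supported in `Ω` it is an
equality: a partition of unity reduces it to balls, where one integrates by parts on almost every
line and applies Fubini. Near a `C¹` boundary point, `Ω` is `{F < 0}` with `F` the graph function,
and `Ψ` is multiplied by a cutoff `η_n` that vanishes for `F > -1/n` and is `1` for `F < -2/n`. The
error is `n` times an integral over a layer of volume `O(1/n)`, with integrand at most a constant
times any prescribed `δ > 0` for large `n`: `Ψ ∇F · V` is continuous and nonpositive on the
boundary. The sign there is assumed only almost everywhere, but it extends to every `C¹` point
because pieces of the graph have positive surface measure.

The boundary points in the support of `Ψ` that are not `C¹` form a compact `H^{d-1}`-null set.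
Finitely many balls with small `∑ r^{d-1}` cover it, and the product of the corresponding cutoffs
has a gradient of `L¹` norm `O(∑ r^{d-1})`. As `Ψ V` is bounded, this error vanishes in the limit
too. -/

/-! ### Fubini along lines parallel to a coordinate axis -/

section Lines

variable {d : ℕ}

local notation "E" => EuclideanSpace ℝ (Fin d)

theorem measurable_line_map (i : Fin d) :
    Measurable (fun z : E × ℝ => z.1 + z.2 • stdVec i) := by
  fun_prop

/-- Fubini along the `i`-th coordinate direction: sweeping the slab `0 ≤ x_i ≤ 1` along the
lines parallel to the `i`-th axis covers the space evenly. -/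
theorem measurePreserving_line_map (i : Fin d) :
    MeasurePreserving (fun z : E × ℝ => z.1 + z.2 • stdVec i)
      (((volume : Measure E).restrict {x | x i ∈ Icc (0 : ℝ) 1}).prod volume) volume := by
  refine ⟨measurable_line_map i, ?_⟩
  have hS : MeasurableSet {x : E | x i ∈ Icc (0 : ℝ) 1} := by
    apply measurableSet_Icc.preimage; fun_prop
  ext B hB
  have hpre := measurable_line_map i hB
  rw [Measure.map_apply (measurable_line_map i) hB, Measure.prod_apply_symm hpre]
  -- After the substitution `y = x + r e_i` the slab condition reads `y_i - r ∈ [0, 1]`; for fixed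
  -- `y` this is an interval of `r` of length one.
  set T : Set (E × ℝ) := {z | z.1 ∈ B ∧ z.1 i - z.2 ∈ Icc (0 : ℝ) 1} with hT
  have hTm : MeasurableSet T := by
    apply MeasurableSet.inter
    · exact measurable_fst hB
    · apply measurableSet_Icc.preimage; fun_prop
  have h1 : ∀ r : ℝ, (volume.restrict {x : E | x i ∈ Icc (0 : ℝ) 1})
      ((fun x => (x, r)) ⁻¹' ((fun z : E × ℝ => z.1 + z.2 • stdVec i) ⁻¹' B)) =
      volume ((fun y : E => (y, r)) ⁻¹' T) := by
    intro r
    rw [Measure.restrict_apply' hS, ← measure_preimage_add_right volume (r • stdVec i)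
      ((fun y : E => (y, r)) ⁻¹' T)]
    congr 1
    ext x
    simp only [T, mem_inter_iff, mem_preimage, mem_ofPred_eq, PiLp.add_apply, PiLp.smul_apply,
      stdVec, PiLp.single_apply, if_true, smul_eq_mul, mul_one, add_sub_cancel_right]
  simp_rw [h1]
  rw [← Measure.prod_apply_symm hTm, Measure.prod_apply hTm]
  have h2 : ∀ y : E, volume (Prod.mk y ⁻¹' T) = B.indicator 1 y := by
    intro y
    by_cases hy : y ∈ B
    · have : Prod.mk y ⁻¹' T = Icc (y i - 1) (y i) := by
        ext r
        simp only [T, mem_preimage, mem_ofPred_eq, hy, true_and, mem_Icc]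
        constructor <;> rintro ⟨h, h'⟩ <;> constructor <;> linarith
      simp [this, hy]
    · have : Prod.mk y ⁻¹' T = ∅ := by ext r; simp [T, hy]
      simp [this, hy]
  simp_rw [h2]
  rw [lintegral_indicator_one hB]

theorem integral_eq_zero_of_ae_line (i : Fin d) {H : E → ℝ} (hH : Integrable H)
    (h : ∀ᵐ x : E, ∫ r : ℝ, H (x + r • stdVec i) = 0) : ∫ x, H x = 0 := by
  have hmp := measurePreserving_line_map i
  have hint : Integrable (fun z : E × ℝ => H (z.1 + z.2 • stdVec i)) _ :=
    hmp.integrable_comp_of_integrable hH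
  rw [← hmp.map_eq, integral_map (measurable_line_map i).aemeasurable
    (by rw [hmp.map_eq]; exact hH.1), integral_prod _ hint]
  refine integral_eq_zero_of_ae ?_
  filter_upwards [ae_restrict_of_ae h] with x hx using hx

theorem volume_eq_zero_of_ae_line (i : Fin d) {N : Set E} (hN : MeasurableSet N)
    (h : ∀ᵐ x : E, volume {r : ℝ | x + r • stdVec i ∈ N} = 0) : volume N = 0 := by
  have hmp := measurePreserving_line_map i
  rw [← hmp.measure_preimage hN.nullMeasurableSet,
    Measure.measure_prod_null (measurable_line_map i hN)]
  filter_upwards [ae_restrict_of_ae h] with x hx using hx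

theorem lineDifferentiableAt_shift {f : E → ℝ} {x v : E} {r : ℝ} :
    LineDifferentiableAt ℝ f (x + r • v) v ↔ DifferentiableAt ℝ (fun s : ℝ => f (x + s • v)) r := by
  have h := differentiableAt_comp_add_left (𝕜 := ℝ) (f := fun s : ℝ => f (x + s • v)) (a := r) (x := (0 : ℝ))
  simp only [add_zero, add_smul, ← add_assoc] at h
  exact h

theorem deriv_line_eq_partialDeriv {f : E → ℝ} {x : E} {i : Fin d} {r : ℝ} :
    deriv (fun s : ℝ => f (x + s • stdVec i)) r = partialDeriv i f (x + r • stdVec i) := by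
  have h := deriv_comp_const_add (fun s : ℝ => f (x + s • stdVec i)) r 0
  simp only [add_zero, add_smul, ← add_assoc] at h
  exact h.symm

end Lines

/-! ### Calculus of Tonelli absolutely continuous functions -/

section AbsCont

variable {d : ℕ}

local notation "E" => EuclideanSpace ℝ (Fin d)

variable {Ω D : Set (EuclideanSpace ℝ (Fin d))}

theorem subset_closure_diff_of_isOpen (hΩ : IsOpen Ω) (hD : D ⊆ frontier Ω) :
    Ω ⊆ closure Ω \ D := fun x hx =>
  ⟨subset_closure hx, fun h => by
    have := hD h
    rw [hΩ.frontier_eq] at this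
    exact this.2 hx⟩

/-- On almost every line parallel to the `i`-th axis, an absolutely continuous function is
differentiable almost everywhere on the part of the line in `Ω`. -/
theorem IsAbsCont.ae_line_differentiableAt {f : E → ℝ} (hf : IsAbsCont Ω D f) (hΩ : IsOpen Ω)
    (i : Fin d) :
    ∀ᵐ x : E, volume {r : ℝ | x + r • stdVec i ∈ Ω ∧
      ¬ DifferentiableAt ℝ (fun s : ℝ => f (x + s • stdVec i)) r} = 0 := by
  filter_upwards [hf.ae_line i] with x hx
  refine measure_null_of_locally_null _ fun r hr => ?_
  have hcont : Continuous fun s : ℝ => x + s • stdVec i := by fun_prop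
  have hopen : IsOpen {s : ℝ | x + s • stdVec i ∈ Ω} := hΩ.preimage hcont
  obtain ⟨ε, hε, hball⟩ := Metric.isOpen_iff.1 hopen r hr.1
  have hsub : ∀ s ∈ Icc (r - ε / 2) (r + ε / 2), x + s • stdVec i ∈ Ω := by
    intro s hs
    apply hball
    rw [Metric.mem_ball, Real.dist_eq, abs_lt]
    constructor <;> linarith [hs.1, hs.2]
  have hac := (hx (r - ε / 2) (r + ε / 2) (by linarith) hsub).ae_differentiableAt
  rw [uIcc_of_le (by linarith)] at hac
  refine ⟨_, inter_mem_nhdsWithin _ (Icc_mem_nhds (by linarith : r - ε / 2 < r)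
    (by linarith : r < r + ε / 2)), ?_⟩
  refine measure_mono_null ?_ hac
  rintro s ⟨⟨_, hs⟩, hs'⟩ h
  exact hs (h hs')

/-- Fubini needs the exceptional set to be measurable, which holds for a function continuous on the
whole space. Hence `f` is first multiplied by a bump function that equals `1` near the given point.
The result justifies the sum and product rules for partial derivatives almost everywhere. -/
theorem IsAbsCont.ae_lineDifferentiableAt {f : E → ℝ} (hf : IsAbsCont Ω D f) (hΩ : IsOpen Ω)
    (hD : D ⊆ frontier Ω) (i : Fin d) :
    ∀ᵐ x : E, x ∈ Ω → LineDifferentiableAt ℝ f x (stdVec i) := by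
  rw [ae_iff]
  refine measure_null_of_locally_null _ fun x₀ hx₀ => ?_
  have hx₀Ω : x₀ ∈ Ω := by by_contra h; exact hx₀ fun h' => absurd h' h
  obtain ⟨ρ, hρ, hball⟩ := Metric.isOpen_iff.1 hΩ x₀ hx₀Ω
  let χ : ContDiffBump x₀ := ⟨ρ / 4, ρ / 2, by positivity, by linarith⟩
  have htsupp : tsupport χ ⊆ Ω := by
    rw [χ.tsupport_eq]
    exact (Metric.closedBall_subset_ball (by change ρ / 2 < ρ; linarith)).trans hball
  have hcont : Continuous fun x => χ x * f x := by
    rw [continuous_iff_continuousAt]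
    intro x
    by_cases hx : x ∈ tsupport χ
    · have hfc : ContinuousAt f x :=
        (hf.continuousOn.mono (subset_closure_diff_of_isOpen hΩ hD)).continuousAt
          (hΩ.mem_nhds (htsupp hx))
      exact χ.continuous.continuousAt.mul hfc
    · have : (fun x => χ x * f x) =ᶠ[𝓝 x] fun _ => 0 := by
        filter_upwards [notMem_tsupport_iff_eventuallyEq.1 hx] with y hy
        simp [hy]
      exact continuousAt_const.congr this.symm
  have heq : ∀ x ∈ Metric.ball x₀ (ρ / 4), (fun x => χ x * f x) =ᶠ[𝓝 x] f := by
    intro x hx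
    filter_upwards [Metric.isOpen_ball.mem_nhds hx] with y hy
    rw [χ.one_of_mem_closedBall (Metric.ball_subset_closedBall hy), one_mul]
  refine ⟨_, inter_mem_nhdsWithin _ (Metric.ball_mem_nhds x₀ (by positivity : 0 < ρ / 4)), ?_⟩
  have hNm : MeasurableSet ({x : E | ¬ LineDifferentiableAt ℝ (fun x => χ x * f x) x (stdVec i)} ∩
      Metric.ball x₀ (ρ / 4)) :=
    (measurableSet_lineDifferentiableAt hcont).compl.inter Metric.isOpen_ball.measurableSet
  refine measure_mono_null ?_ (volume_eq_zero_of_ae_line i hNm ?_)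
  · rintro x ⟨hx, hxb⟩
    refine ⟨fun h => hx fun _ => ?_, hxb⟩
    exact h.congr_of_eventuallyEq (heq x hxb).symm
  · filter_upwards [hf.ae_line_differentiableAt hΩ i] with x hx
    refine measure_mono_null ?_ hx
    rintro r ⟨hr, hrb⟩
    refine ⟨hball (Metric.ball_subset_ball (by linarith) hrb), fun h => hr ?_⟩
    exact (lineDifferentiableAt_shift.2 h).congr_of_eventuallyEq (heq _ hrb)

theorem isAbsCont_const (c : ℝ) : IsAbsCont Ω D (fun _ => c) where
  continuousOn := continuousOn_const
  ae_line i := by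
    refine Eventually.of_forall fun x s t _ _ => ?_
    exact contDiffOn_const.absolutelyContinuousOnInterval
  integrableOn i K _ _ := by
    have : partialDeriv i (fun _ : E => c) = 0 := by
      ext x; simp [partialDeriv, lineDeriv]
    rw [this]
    exact integrableOn_zero

theorem IsAbsCont.add {f g : E → ℝ} (hf : IsAbsCont Ω D f) (hg : IsAbsCont Ω D g)
    (hΩ : IsOpen Ω) (hD : D ⊆ frontier Ω) : IsAbsCont Ω D (fun x => f x + g x) where
  continuousOn := hf.continuousOn.add hg.continuousOn
  ae_line i := by
    filter_upwards [hf.ae_line i, hg.ae_line i] with x hfx hgx s t hst hsub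
    exact (hfx s t hst hsub).add (hgx s t hst hsub)
  integrableOn i K hK hKD := by
    refine ((hf.integrableOn i K hK hKD).add (hg.integrableOn i K hK hKD)).congr ?_
    have h1 := ae_restrict_of_ae (s := Ω ∩ K) (hf.ae_lineDifferentiableAt hΩ hD i)
    have h2 := ae_restrict_of_ae (s := Ω ∩ K) (hg.ae_lineDifferentiableAt hΩ hD i)
    filter_upwards [h1, h2, self_mem_ae_restrict (hΩ.measurableSet.inter hK.measurableSet)]
      with x hx1 hx2 hx
    exact (HasDerivAt.deriv ((hx1 hx.1).hasLineDerivAt.add (hx2 hx.1).hasLineDerivAt)).symm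

theorem closure_inter_subset_of_disjoint {K : Set E} (hKD : Disjoint K D) :
    closure Ω ∩ K ⊆ closure Ω \ D :=
  fun _ hx => ⟨hx.1, fun h => hKD.le_bot ⟨hx.2, h⟩⟩

/-- Since `K` avoids `D`, `f` is continuous up to the boundary on the compact set `closure Ω ∩ K`,
hence bounded there. -/
theorem integrableOn_mul_of_continuousOn {f h : E → ℝ} (hf : ContinuousOn f (closure Ω \ D))
    (hΩ : IsOpen Ω) {K : Set E} (hK : IsCompact K) (hKD : Disjoint K D)
    (hh : IntegrableOn h (Ω ∩ K)) : IntegrableOn (fun x => f x * h x) (Ω ∩ K) := by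
  have hc : ContinuousOn f (closure Ω ∩ K) := hf.mono (closure_inter_subset_of_disjoint hKD)
  obtain ⟨C, hC⟩ := (hK.inter_left isClosed_closure).exists_bound_of_continuousOn hc
  have hm : MeasurableSet (Ω ∩ K) := hΩ.measurableSet.inter hK.measurableSet
  have hsub : Ω ∩ K ⊆ closure Ω ∩ K := inter_subset_inter_left _ subset_closure
  refine Integrable.bdd_mul (c := C) hh ((hc.mono hsub).aestronglyMeasurable hm) ?_
  filter_upwards [self_mem_ae_restrict hm] with x hx using hC x (hsub hx)

theorem IsAbsCont.mul {f g : E → ℝ} (hf : IsAbsCont Ω D f) (hg : IsAbsCont Ω D g)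
    (hΩ : IsOpen Ω) (hD : D ⊆ frontier Ω) : IsAbsCont Ω D (fun x => f x * g x) where
  continuousOn := hf.continuousOn.mul hg.continuousOn
  ae_line i := by
    filter_upwards [hf.ae_line i, hg.ae_line i] with x hfx hgx s t hst hsub
    exact (hfx s t hst hsub).mul (hgx s t hst hsub)
  integrableOn i K hK hKD := by
    refine ((integrableOn_mul_of_continuousOn hg.continuousOn hΩ hK hKD
      (hf.integrableOn i K hK hKD)).add (integrableOn_mul_of_continuousOn hf.continuousOn hΩ hK hKD
      (hg.integrableOn i K hK hKD))).congr ?_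
    have h1 := ae_restrict_of_ae (s := Ω ∩ K) (hf.ae_lineDifferentiableAt hΩ hD i)
    have h2 := ae_restrict_of_ae (s := Ω ∩ K) (hg.ae_lineDifferentiableAt hΩ hD i)
    filter_upwards [h1, h2, self_mem_ae_restrict (hΩ.measurableSet.inter hK.measurableSet)]
      with x hx1 hx2 hx
    have := HasDerivAt.mul (hx1 hx.1).hasLineDerivAt (hx2 hx.1).hasLineDerivAt
    simp only [zero_smul, add_zero] at this
    refine Eq.trans ?_ (HasDerivAt.deriv this).symm
    simp only [partialDeriv, Pi.add_apply]
    ring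

theorem isAbsCont_sum {ι : Type*} (s : Finset ι) {f : ι → E → ℝ}
    (hf : ∀ j ∈ s, IsAbsCont Ω D (f j)) (hΩ : IsOpen Ω) (hD : D ⊆ frontier Ω) :
    IsAbsCont Ω D (fun x => ∑ j ∈ s, f j x) := by
  classical
  induction s using Finset.induction_on with
  | empty => simpa using isAbsCont_const 0
  | insert j s hj ih =>
    simp only [Finset.sum_insert hj]
    exact (hf j (by simp)).add (ih fun k hk => hf k (by simp [hk])) hΩ hD

end AbsCont

/-! ### Flux inequality inside `Ω`, and localization -/

section Interior

variable {d : ℕ}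

local notation "E" => EuclideanSpace ℝ (Fin d)

variable {Ω D : Set (EuclideanSpace ℝ (Fin d))}

/-- Nonnegative `C¹` functions with compact support in the complement of `D`. -/
structure IsNonnegTest (D : Set E) (Ψ : E → ℝ) : Prop where
  contDiff : ContDiff ℝ 1 Ψ
  nonneg : ∀ x, 0 ≤ Ψ x
  hasCompactSupport : HasCompactSupport Ψ
  disjoint : Disjoint (tsupport Ψ) D

/-- The weak form of the statement that `V` flows into `Ω` through the boundary, tested
against `Ψ`. -/
def FluxIneq (Ω : Set E) (V : E → E) (Ψ : E → ℝ) : Prop :=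
  ∫ x in Ω, divergence V x * Ψ x ≤ - ∫ x in Ω, fderiv ℝ Ψ x (V x)

theorem integral_deriv_mul_add_eq_zero {k φ : ℝ → ℝ} {I K : Set ℝ} (hI : IsOpen I)
    (hconn : I.OrdConnected)
    (hk : ∀ s t, s ≤ t → Icc s t ⊆ I → AbsolutelyContinuousOnInterval k s t)
    (hφ : ContDiff ℝ 1 φ) (hK : IsCompact K) (hKI : K ⊆ I) (hφK : Function.support φ ⊆ K) :
    ∫ r, (deriv k r * φ r + k r * deriv φ r) = 0 := by
  have hsupp : Function.support (fun r => deriv k r * φ r + k r * deriv φ r) ⊆ K := by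
    intro r hr
    by_contra hrK
    have h1 : φ r = 0 := by_contra fun h => hrK (hφK h)
    have h2 : deriv φ r = 0 := by
      by_contra h
      exact hrK (closure_minimal hφK hK.isClosed (support_deriv_subset h))
    simp [h1, h2] at hr
  rcases K.eq_empty_or_nonempty with rfl | hne
  · rw [Function.support_subset_iff'] at hsupp
    exact integral_eq_zero_of_ae (Eventually.of_forall fun r => hsupp r (by simp))
  have hs0 := hKI (hK.sInf_mem hne)
  have ht0 := hKI (hK.sSup_mem hne)
  obtain ⟨ε, hε, hbs⟩ := Metric.isOpen_iff.1 hI _ hs0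
  obtain ⟨δ, hδ, hbt⟩ := Metric.isOpen_iff.1 hI _ ht0
  -- `φ` may be nonzero at the ends of `K`, so the interval is widened slightly within `I` to make
  -- the boundary terms vanish.
  set s := sInf K - ε / 2 with hs
  set t := sSup K + δ / 2 with ht
  have hsI : s ∈ I := hbs (by rw [Metric.mem_ball, Real.dist_eq, abs_lt]; constructor <;> linarith)
  have htI : t ∈ I := hbt (by rw [Metric.mem_ball, Real.dist_eq, abs_lt]; constructor <;> linarith)
  have hKs : ∀ r ∈ K, s < r ∧ r < t := fun r hr =>
    ⟨by linarith [csInf_le hK.bddBelow hr], by linarith [le_csSup hK.bddAbove hr]⟩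
  obtain ⟨r, hr⟩ := hne
  have hst : s ≤ t := ((hKs r hr).1.trans (hKs r hr).2).le
  have hφs : φ s = 0 := by_contra fun h => lt_irrefl _ (hKs s (hφK h)).1
  have hφt : φ t = 0 := by_contra fun h => lt_irrefl _ (hKs t (hφK h)).2
  rw [← intervalIntegral.integral_eq_integral_of_support_subset
    (hsupp.trans fun r hr => ⟨(hKs r hr).1, (hKs r hr).2.le⟩),
    (hk s t hst (hconn.out hsI htI)).integral_deriv_mul_eq_sub
      hφ.contDiffOn.absolutelyContinuousOnInterval, hφs, hφt]
  simp

theorem integrableOn_of_continuousOn_of_eq_zero {h : E → ℝ} (hc : ContinuousOn h (closure Ω \ D))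
    (hΩ : IsOpen Ω) {K : Set E} (hK : IsCompact K) (hKD : Disjoint K D) (h0 : ∀ x ∉ K, h x = 0) :
    IntegrableOn h Ω := by
  have h1 : IntegrableOn h (closure Ω ∩ K) :=
    (hc.mono (closure_inter_subset_of_disjoint hKD)).integrableOn_compact
      (hK.inter_left isClosed_closure)
  refine (h1.mono_set (inter_subset_inter_left K subset_closure)).of_forall_sdiff_eq_zero
    hΩ.measurableSet fun x hx => h0 x fun hxK => hx.2 ⟨hx.1, hxK⟩

theorem integrableOn_mul_of_integrableOn_inter {Ψ w : E → ℝ} (hΨ : Continuous Ψ)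
    (hΨc : HasCompactSupport Ψ) (hΩ : IsOpen Ω) (hw : IntegrableOn w (Ω ∩ tsupport Ψ)) :
    IntegrableOn (fun x => w x * Ψ x) Ω := by
  obtain ⟨C, hC⟩ := hΨc.exists_bound_of_continuous hΨ
  have h1 : IntegrableOn (fun x => w x * Ψ x) (Ω ∩ tsupport Ψ) :=
    hw.mul_bdd (c := C) hΨ.aestronglyMeasurable (Eventually.of_forall hC)
  refine h1.of_forall_sdiff_eq_zero hΩ.measurableSet fun x hx => ?_
  rw [image_eq_zero_of_notMem_tsupport fun hxK => hx.2 ⟨hx.1, hxK⟩, mul_zero]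

theorem continuousOn_of_components {V : E → E} {s : Set E}
    (hV : ∀ i, ContinuousOn (fun x => V x i) s) : ContinuousOn V s :=
  (PiLp.continuous_toLp 2 _).comp_continuousOn (continuousOn_pi.2 hV)

theorem integrableOn_divergence {V : E → E} (hV : ∀ i, IsAbsCont Ω D (fun x => V x i)) {K : Set E}
    (hK : IsCompact K) (hKD : Disjoint K D) : IntegrableOn (divergence V) (Ω ∩ K) :=
  integrable_finsetSum _ fun i _ => (hV i).integrableOn i K hK hKD

theorem continuousOn_fderiv_apply {V : E → E} (hV : ∀ i, IsAbsCont Ω D (fun x => V x i))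
    {Ψ : E → ℝ} (hΨ : ContDiff ℝ 1 Ψ) :
    ContinuousOn (fun x => fderiv ℝ Ψ x (V x)) (closure Ω \ D) :=
  (hΨ.continuous_fderiv one_ne_zero).continuousOn.clm_apply
    (continuousOn_of_components fun i => (hV i).continuousOn)

theorem fderiv_eq_zero_of_notMem_tsupport {Ψ : E → ℝ} {x : E} (hx : x ∉ tsupport Ψ) :
    fderiv ℝ Ψ x = 0 :=
  by_contra fun h => hx (support_fderiv_subset ℝ h)

theorem IsNonnegTest.integrableOn_fderiv_apply {V : E → E}
    (hV : ∀ i, IsAbsCont Ω D (fun x => V x i)) {Ψ : E → ℝ} (hΨ : IsNonnegTest D Ψ)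
    (hΩ : IsOpen Ω) : IntegrableOn (fun x => fderiv ℝ Ψ x (V x)) Ω :=
  integrableOn_of_continuousOn_of_eq_zero (continuousOn_fderiv_apply hV hΨ.contDiff) hΩ
    hΨ.hasCompactSupport hΨ.disjoint fun x hx => by
      rw [fderiv_eq_zero_of_notMem_tsupport hx]; rfl

theorem IsNonnegTest.integrableOn_divergence_mul {V : E → E}
    (hV : ∀ i, IsAbsCont Ω D (fun x => V x i)) {Ψ : E → ℝ} (hΨ : IsNonnegTest D Ψ)
    (hΩ : IsOpen Ω) : IntegrableOn (fun x => divergence V x * Ψ x) Ω :=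
  integrableOn_mul_of_integrableOn_inter hΨ.contDiff.continuous hΨ.hasCompactSupport hΩ
    (integrableOn_divergence hV hΨ.hasCompactSupport hΨ.disjoint)

/-- Integration by parts for a test function supported in a ball contained in `Ω`. -/
theorem IsAbsCont.integral_partialDeriv_mul_add_eq_zero {f : E → ℝ} (hf : IsAbsCont Ω D f)
    (hΩ : IsOpen Ω) (hD : D ⊆ frontier Ω) (i : Fin d) {Φ : E → ℝ} (hΦ : ContDiff ℝ 1 Φ)
    (hΦc : HasCompactSupport Φ) {x₀ : E} {ρ : ℝ} (hball : Metric.ball x₀ ρ ⊆ Ω)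
    (hsupp : tsupport Φ ⊆ Metric.ball x₀ ρ) :
    IntegrableOn (fun x => partialDeriv i f x * Φ x) Ω ∧
    IntegrableOn (fun x => f x * fderiv ℝ Φ x (stdVec i)) Ω ∧
    ∫ x in Ω, (partialDeriv i f x * Φ x + f x * fderiv ℝ Φ x (stdVec i)) = 0 := by
  have hdis : Disjoint (tsupport Φ) D := by
    refine disjoint_left.2 fun x hx hxD => ?_
    exact (subset_closure_diff_of_isOpen hΩ hD (hball (hsupp hx))).2 hxD
  have hi1 : IntegrableOn (fun x => partialDeriv i f x * Φ x) Ω :=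
    integrableOn_mul_of_integrableOn_inter hΦ.continuous hΦc hΩ (hf.integrableOn i _ hΦc hdis)
  have hi2 : IntegrableOn (fun x => f x * fderiv ℝ Φ x (stdVec i)) Ω := by
    refine integrableOn_of_continuousOn_of_eq_zero (hf.continuousOn.mul ?_) hΩ hΦc hdis
      fun x hx => by rw [fderiv_eq_zero_of_notMem_tsupport hx]; simp
    exact ((hΦ.continuous_fderiv one_ne_zero).clm_apply continuous_const).continuousOn
  refine ⟨hi1, hi2, ?_⟩
  set H : E → ℝ := fun x => partialDeriv i f x * Φ x + f x * fderiv ℝ Φ x (stdVec i) with hH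
  have hH0 : ∀ x ∉ tsupport Φ, H x = 0 := fun x hx => by
    simp [hH, fderiv_eq_zero_of_notMem_tsupport hx, image_eq_zero_of_notMem_tsupport hx]
  have hH0' : ∀ x ∉ Ω, H x = 0 := fun x hx => hH0 x fun h => hx (hball (hsupp h))
  rw [setIntegral_eq_integral_of_forall_compl_eq_zero hH0']
  have hHint : Integrable H :=
    (integrableOn_iff_integrable_of_support_subset
      (Function.support_subset_iff'.2 hH0')).1 (hi1.add hi2)
  refine integral_eq_zero_of_ae_line i hHint ?_
  filter_upwards [hf.ae_line i] with x hx
  have hline : Continuous fun r : ℝ => x + r • stdVec i := by fun_prop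
  have hφ : ContDiff ℝ 1 fun r : ℝ => Φ (x + r • stdVec i) := by
    refine hΦ.comp ?_
    fun_prop
  have hderiv : ∀ r : ℝ, deriv (fun r : ℝ => Φ (x + r • stdVec i)) r =
      fderiv ℝ Φ (x + r • stdVec i) (stdVec i) := by
    intro r
    have h1 : HasDerivAt (fun r : ℝ => x + r • stdVec i) (stdVec i) r := by
      simpa using ((hasDerivAt_id r).smul_const (stdVec i)).const_add x
    exact ((hΦ.differentiable one_ne_zero _).hasFDerivAt.comp_hasDerivAt r h1).deriv
  have hK : IsCompact {r : ℝ | x + r • stdVec i ∈ tsupport Φ} := by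
    refine (hΦc.isCompact.image (f := fun y : E => y i - x i) (by fun_prop)).of_isClosed_subset
      ((isClosed_tsupport Φ).preimage hline) fun r hr => ⟨_, hr, ?_⟩
    simp [stdVec]
  -- A ball is convex, so the line meets it in an interval; for `Ω` itself this could fail.
  have hconn : ({r : ℝ | x + r • stdVec i ∈ Metric.ball x₀ ρ}).OrdConnected := by
    have := (convex_ball x₀ ρ).affine_preimage (AffineMap.lineMap x (x + stdVec i) : ℝ →ᵃ[ℝ] E)
    have h2 : (AffineMap.lineMap x (x + stdVec i) : ℝ →ᵃ[ℝ] E) ⁻¹' Metric.ball x₀ ρ =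
        {r : ℝ | x + r • stdVec i ∈ Metric.ball x₀ ρ} := by
      ext r
      simp [AffineMap.lineMap_apply, add_comm]
    rw [h2] at this
    exact this.ordConnected
  have h1d := integral_deriv_mul_add_eq_zero (k := fun r : ℝ => f (x + r • stdVec i))
    (Metric.isOpen_ball.preimage hline) hconn
    (fun s t hst hsub => hx s t hst fun r hr => hball (hsub hr)) hφ hK
    (fun r hr => hsupp hr) (fun r hr => subset_tsupport Φ hr)
  simp only [deriv_line_eq_partialDeriv, hderiv] at h1d
  exact h1d

/-- Multiply `Ψ` by a smooth partition of unity subordinate to a finite subcover of its support. The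
pieces stay nonnegative, as a one-sided inequality requires. -/
theorem IsNonnegTest.exists_sum_localized {Ψ : E → ℝ} (hΨ : IsNonnegTest D Ψ)
    {P : (E → ℝ) → Prop}
    (h : ∀ x ∈ tsupport Ψ, ∃ U, IsOpen U ∧ x ∈ U ∧ ∀ Φ, IsNonnegTest D Φ → tsupport Φ ⊆ U →
      tsupport Φ ⊆ tsupport Ψ → P Φ) :
    ∃ (ι : Type) (_ : Fintype ι) (Φ : ι → E → ℝ), (∀ k, IsNonnegTest D (Φ k) ∧ P (Φ k)) ∧
      Ψ = fun x => ∑ k, Φ k x := by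
  choose! U hUo hxU hU using h
  obtain ⟨t, htK, htc⟩ := hΨ.hasCompactSupport.isCompact.elim_nhds_subcover U
    fun x hx => (hUo x hx).mem_nhds (hxU x hx)
  have hcover : tsupport Ψ ⊆ ⋃ k : {x // x ∈ t}, U k := by
    intro x hx
    obtain ⟨k, hk, hxk⟩ := mem_iUnion₂.1 (htc hx)
    exact mem_iUnion.2 ⟨⟨k, hk⟩, hxk⟩
  obtain ⟨f, hf⟩ := SmoothPartitionOfUnity.exists_isSubordinate (modelWithCornersSelf ℝ E)
    (isClosed_tsupport Ψ) (fun k : {x // x ∈ t} => U k) (fun k => hUo k (htK k k.2)) hcover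
  have hts : ∀ k, tsupport (fun x => Ψ x * f k x) ⊆ tsupport Ψ := fun k =>
    closure_mono (Function.support_mul_subset_left _ _)
  have htest : ∀ k, IsNonnegTest D fun x => Ψ x * f k x := fun k =>
    { contDiff := hΨ.contDiff.mul ((f k).contMDiff.contDiff.of_le (by norm_num))
      nonneg := fun x => mul_nonneg (hΨ.nonneg x) (f.nonneg k x)
      hasCompactSupport := hΨ.hasCompactSupport.mul_right
      disjoint := hΨ.disjoint.mono_left (hts k) }
  refine ⟨{x // x ∈ t}, inferInstance, fun k x => Ψ x * f k x, fun k => ⟨htest k, ?_⟩, ?_⟩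
  · exact hU k (htK k k.2) _ (htest k)
      ((closure_mono (Function.support_mul_subset_right _ _)).trans (hf k)) (hts k)
  · ext x
    rw [← Finset.mul_sum]
    by_cases hx : x ∈ tsupport Ψ
    · have := f.sum_eq_one hx
      rw [finsum_eq_sum_of_fintype] at this
      rw [this, mul_one]
    · rw [image_eq_zero_of_notMem_tsupport hx, zero_mul]

theorem fluxIneq_sum {ι : Type} [Fintype ι] {V : E → E} (hV : ∀ i, IsAbsCont Ω D (fun x => V x i))
    (hΩ : IsOpen Ω) {Φ : ι → E → ℝ} (hΦ : ∀ k, IsNonnegTest D (Φ k) ∧ FluxIneq Ω V (Φ k)) :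
    FluxIneq Ω V (fun x => ∑ k, Φ k x) := by
  have hfd : ∀ x, fderiv ℝ (fun x => ∑ k, Φ k x) x = ∑ k, fderiv ℝ (Φ k) x := fun x =>
    fderiv_fun_sum fun k _ => (hΦ k).1.contDiff.differentiable one_ne_zero x
  simp only [FluxIneq, hfd, Finset.mul_sum, FunLike.coe_sum, Finset.sum_apply]
  rw [integral_finsetSum _ fun k _ => (hΦ k).1.integrableOn_divergence_mul hV hΩ,
    integral_finsetSum _ fun k _ => (hΦ k).1.integrableOn_fderiv_apply hV hΩ,
    ← Finset.sum_neg_distrib]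
  exact Finset.sum_le_sum fun k _ => (hΦ k).2

/-- Both sides of the flux inequality are linear in the test function, so the inequalities for the
localized pieces add up. -/
theorem IsNonnegTest.fluxIneq_of_locally {V : E → E} (hV : ∀ i, IsAbsCont Ω D (fun x => V x i))
    (hΩ : IsOpen Ω) {Ψ : E → ℝ} (hΨ : IsNonnegTest D Ψ)
    (h : ∀ x ∈ tsupport Ψ, ∃ U, IsOpen U ∧ x ∈ U ∧ ∀ Φ, IsNonnegTest D Φ → tsupport Φ ⊆ U →
      tsupport Φ ⊆ tsupport Ψ → FluxIneq Ω V Φ) : FluxIneq Ω V Ψ := by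
  obtain ⟨ι, _, Φ, hΦ, rfl⟩ := hΨ.exists_sum_localized h
  exact fluxIneq_sum hV hΩ hΦ

theorem sum_smul_stdVec (v : E) : ∑ i, v i • stdVec i = v := by
  ext j
  simp [stdVec, Finset.sum_apply, Pi.single_apply]

theorem IsNonnegTest.fluxIneq_of_subset_ball {V : E → E}
    (hV : ∀ i, IsAbsCont Ω D (fun x => V x i)) (hΩ : IsOpen Ω) (hD : D ⊆ frontier Ω) {Ψ : E → ℝ}
    (hΨ : IsNonnegTest D Ψ) {x₀ : E} {ρ : ℝ} (hball : Metric.ball x₀ ρ ⊆ Ω)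
    (hsupp : tsupport Ψ ⊆ Metric.ball x₀ ρ) : FluxIneq Ω V Ψ := by
  have h := fun i => (hV i).integral_partialDeriv_mul_add_eq_zero hΩ hD i hΨ.contDiff
    hΨ.hasCompactSupport hball hsupp
  have hfd : ∀ x, fderiv ℝ Ψ x (V x) = ∑ i, V x i * fderiv ℝ Ψ x (stdVec i) := fun x => by
    conv_lhs => rw [← sum_smul_stdVec (V x)]
    simp
  simp only [FluxIneq, hfd, divergence, Finset.sum_mul]
  rw [integral_finsetSum _ fun i _ => (h i).1, integral_finsetSum _ fun i _ => (h i).2.1,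
    ← Finset.sum_neg_distrib]
  refine Finset.sum_le_sum fun i _ => ?_
  have h3 := (h i).2.2
  rw [integral_add (h i).1 (h i).2.1] at h3
  linarith

theorem IsNonnegTest.fluxIneq_of_subset {V : E → E} (hV : ∀ i, IsAbsCont Ω D (fun x => V x i))
    (hΩ : IsOpen Ω) (hD : D ⊆ frontier Ω) {Ψ : E → ℝ} (hΨ : IsNonnegTest D Ψ)
    (hsupp : tsupport Ψ ⊆ Ω) : FluxIneq Ω V Ψ := by
  refine hΨ.fluxIneq_of_locally hV hΩ fun x hx => ?_
  obtain ⟨ρ, hρ, hball⟩ := Metric.isOpen_iff.1 hΩ x (hsupp hx)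
  exact ⟨_, Metric.isOpen_ball, Metric.mem_ball_self hρ,
    fun Φ hΦ hΦU _ => hΦ.fluxIneq_of_subset_ball hV hΩ hD hball hΦU⟩

theorem fluxIneq_of_disjoint {V : E → E} {Ψ : E → ℝ}
    (hΨ : Disjoint (tsupport Ψ) Ω) : FluxIneq Ω V Ψ := by
  have hn : ∀ x ∈ Ω, x ∉ tsupport Ψ := fun x hx h => hΨ.le_bot ⟨h, hx⟩
  rw [FluxIneq, setIntegral_eq_zero_of_forall_eq_zero fun x hx => by
      rw [image_eq_zero_of_notMem_tsupport (hn x hx), mul_zero],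
    setIntegral_eq_zero_of_forall_eq_zero fun x hx => by
      rw [fderiv_eq_zero_of_notMem_tsupport (hn x hx)]; rfl]
  simp

end Interior

/-! ### Tools for cutoffs -/

/-- On `s ≤ 0` the function attains its global minimum and on `s ≥ 1` its global maximum, so the
derivative vanishes there; in between it is bounded by compactness. -/
theorem smoothTransition_deriv_bound :
    ∃ M : ℝ, 0 ≤ M ∧ (∀ s, 0 ≤ deriv Real.smoothTransition s) ∧
      (∀ s, deriv Real.smoothTransition s ≤ M) ∧
      (∀ s, s ≤ 0 → deriv Real.smoothTransition s = 0) ∧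
      ∀ s, 1 ≤ s → deriv Real.smoothTransition s = 0 := by
  have hC : ContDiff ℝ 1 Real.smoothTransition := Real.smoothTransition.contDiff (n := 1)
  have hcont : Continuous (deriv Real.smoothTransition) := hC.continuous_deriv_one
  have h0 : ∀ s, s ≤ 0 → deriv Real.smoothTransition s = 0 := fun s hs =>
    IsLocalMin.deriv_eq_zero (Eventually.of_forall fun y => by
      rw [Real.smoothTransition.zero_of_nonpos hs]; exact Real.smoothTransition.nonneg y)
  have h1 : ∀ s, 1 ≤ s → deriv Real.smoothTransition s = 0 := fun s hs =>
    IsLocalMax.deriv_eq_zero (Eventually.of_forall fun y => by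
      rw [Real.smoothTransition.one_of_one_le hs]; exact Real.smoothTransition.le_one y)
  obtain ⟨M, hM⟩ := (isCompact_Icc (a := (0 : ℝ)) (b := 1)).exists_bound_of_continuousOn
    hcont.continuousOn
  have hM0 : 0 ≤ M := (norm_nonneg _).trans (hM 0 (by simp))
  refine ⟨M, hM0, fun s => Real.smoothTransition.monotone.deriv_nonneg, fun s => ?_, h0, h1⟩
  by_cases hs : s ∈ Icc (0 : ℝ) 1
  · exact (le_abs_self _).trans (hM s hs)
  · rw [mem_Icc, not_and_or, not_le, not_le] at hs
    rcases hs with hs | hs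
    · rw [h0 s hs.le]; exact hM0
    · rw [h1 s hs.le]; exact hM0

/-- Dominated convergence. Convergence is asked only where `k ≠ 0`, because the local description of
`Ω` is available only on the support of the test function. -/
theorem tendsto_integral_mul_cutoff {α : Type*} [MeasurableSpace α] {μ : Measure α} {k : α → ℝ}
    (hk : Integrable k μ) {h : ℕ → α → ℝ} (hm : ∀ n, AEStronglyMeasurable (h n) μ)
    (hb : ∀ n x, |h n x| ≤ 1)
    (hl : ∀ᵐ x ∂μ, k x ≠ 0 → Tendsto (fun n => h n x) atTop (𝓝 1)) :
    Tendsto (fun n => ∫ x, k x * h n x ∂μ) atTop (𝓝 (∫ x, k x ∂μ)) := by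
  refine tendsto_integral_of_dominated_convergence (fun x => ‖k x‖)
    (fun n => hk.1.mul (hm n)) hk.norm (fun n => Eventually.of_forall fun x => ?_) ?_
  · rw [norm_mul]
    exact mul_le_of_le_one_right (norm_nonneg _) (hb n x)
  · filter_upwards [hl] with x hx
    by_cases h0 : k x = 0
    · simp [h0]
    · simpa using (hx h0).const_mul (k x)

/-! ### Geometry of the region below a graph -/

section Graph

variable {d : ℕ}

local notation "E" => EuclideanSpace ℝ (Fin d)

variable {Ω D : Set (EuclideanSpace ℝ (Fin d))} {e : EuclideanSpace ℝ (Fin d)}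
  {g : EuclideanSpace ℝ (Fin d) → ℝ}

theorem contDiff_graphFun (hg : ContDiff ℝ 1 g) : ContDiff ℝ 1 (graphFun e g) := by
  unfold graphFun
  have h : ContDiff ℝ 1 fun y : E => (inner ℝ e y : ℝ) := contDiff_const.inner ℝ contDiff_id
  exact h.sub (hg.comp (contDiff_id.sub (h.smul contDiff_const)))

theorem graphFun_add_smul (he : ‖e‖ = 1) (y : E) (t : ℝ) :
    graphFun e g (y + t • e) = graphFun e g y + t := by
  have h : (inner ℝ e (y + t • e) : ℝ) = inner ℝ e y + t := by
    rw [inner_add_right, inner_smul_right, real_inner_self_eq_norm_sq, he]; ring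
  have h2 : y + t • e - ((inner ℝ e y : ℝ) + t) • e = y - (inner ℝ e y : ℝ) • e := by
    rw [add_smul]; abel
  rw [graphFun, graphFun, h, h2]
  ring

/-- Inside a neighbourhood on which `Ω` is the region below a graph, the boundary is the graph. -/
theorem mem_frontier_iff_graphFun_eq_zero (hΩ : IsOpen Ω) (he : ‖e‖ = 1) (hg : Continuous g)
    {U : Set E} (hU : IsOpen U) (h : ∀ y ∈ U, y ∈ Ω ↔ graphFun e g y < 0) {y : E} (hy : y ∈ U) :
    y ∈ frontier Ω ↔ graphFun e g y = 0 := by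
  have hF : Continuous (graphFun e g) := by
    unfold graphFun
    fun_prop
  rw [hΩ.frontier_eq]
  constructor
  · rintro ⟨hyc, hyn⟩
    refine le_antisymm ?_ (not_lt.1 fun hlt => hyn ((h y hy).2 hlt))
    by_contra! hpos
    have hnhds : U ∩ {z | 0 < graphFun e g z} ∈ 𝓝 y :=
      inter_mem (hU.mem_nhds hy) ((isOpen_lt continuous_const hF).mem_nhds hpos)
    obtain ⟨z, hz, hzΩ⟩ := mem_closure_iff_nhds.1 hyc _ hnhds
    exact lt_asymm hz.2 ((h z hz.1).1 hzΩ)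
  · intro h0
    refine ⟨?_, fun hyΩ => by rw [h y hy, h0] at hyΩ; exact lt_irrefl _ hyΩ⟩
    have hc : Continuous fun t : ℝ => y + t • e := by fun_prop
    have ht : Tendsto (fun t : ℝ => y + t • e) (𝓝[<] 0) (𝓝 y) := by
      have := hc.tendsto 0
      rw [zero_smul, add_zero] at this
      exact this.mono_left nhdsWithin_le_nhds
    refine mem_closure_of_tendsto ht ?_
    filter_upwards [ht.eventually (hU.mem_nhds hy), self_mem_nhdsWithin] with t htU ht0
    rw [h _ htU, graphFun_add_smul he, h0, zero_add]
    exact ht0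

/-- Relatively open pieces of the graph have positive surface measure. -/
theorem hausdorffMeasure_inter_frontier_ne_zero (hΩ : IsOpen Ω) (he : ‖e‖ = 1) (hg : Continuous g)
    {U : Set E} (hU : IsOpen U) (h : ∀ y ∈ U, y ∈ Ω ↔ graphFun e g y < 0) {y : E} (hy : y ∈ U)
    (hyf : y ∈ frontier Ω) {N : Set E} (hN : N ∈ 𝓝 y) :
    (μH[(d : ℝ) - 1] : Measure E) (N ∩ frontier Ω) ≠ 0 := by
  set W : Submodule ℝ E := (ℝ ∙ e)ᗮ with hW
  have he0 : e ≠ 0 := by rintro rfl; simp at he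
  have hrank : (Module.finrank ℝ W : ℝ) = (d : ℝ) - 1 := by
    have h1 := (ℝ ∙ e).finrank_add_finrank_orthogonal
    rw [finrank_span_singleton he0, finrank_euclideanSpace_fin] at h1
    have h2 : ((1 + Module.finrank ℝ W : ℕ) : ℝ) = d := by exact_mod_cast h1
    push_cast at h2
    linarith
  have hd : (0 : ℝ) ≤ (d : ℝ) - 1 := hrank ▸ Nat.cast_nonneg _
  -- `σ` parametrizes the graph over the hyperplane `e^⊥`. Orthogonal projection is 1-Lipschitz and
  -- inverts `σ`, so the piece of the graph has at least a positive multiple of the `H^{d-1}`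
  -- measure of a neighbourhood in `e^⊥`.
  let σ : W → E := fun w => (w : E) + g w • e
  have hσ : Continuous σ := by fun_prop
  have hin : ∀ w : W, (inner ℝ e (w : E) : ℝ) = 0 := fun w =>
    Submodule.mem_orthogonal_singleton_iff_inner_right.1 w.2
  have hπσ : ∀ w, W.orthogonalProjectionOnto (σ w) = w := by
    intro w
    have h1 : W.orthogonalProjectionOnto e = 0 :=
      Submodule.orthogonalProjectionOnto_orthogonalComplement_singleton_eq_zero e
    simp [σ, map_add, map_smul, h1]
  have hFσ : ∀ w, graphFun e g (σ w) = 0 := by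
    intro w
    rw [graphFun_add_smul he, graphFun, hin]
    simp
  have hy0 := (mem_frontier_iff_graphFun_eq_zero hΩ he hg hU h hy).1 hyf
  have hmem : y - (inner ℝ e y : ℝ) • e ∈ W := by
    rw [hW, Submodule.mem_orthogonal_singleton_iff_inner_right, inner_sub_right, inner_smul_right,
      real_inner_self_eq_norm_sq, he]
    ring
  have hσy : σ ⟨_, hmem⟩ = y := by
    have : (inner ℝ e y : ℝ) = g (y - (inner ℝ e y : ℝ) • e) := sub_eq_zero.1 hy0
    simp only [σ, ← this]
    abel
  have hO : σ ⁻¹' (N ∩ U) ∈ 𝓝 (⟨_, hmem⟩ : W) :=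
    hσ.continuousAt.preimage_mem_nhds (by rw [hσy]; exact inter_mem hN (hU.mem_nhds hy))
  have hpos : 0 < (μH[(d : ℝ) - 1] : Measure W) (σ ⁻¹' (N ∩ U)) := by
    rw [← hrank]
    exact Measure.measure_pos_of_mem_nhds _ hO
  have hsub : σ ⁻¹' (N ∩ U) ⊆ W.orthogonalProjectionOnto '' (N ∩ frontier Ω) := fun w hw =>
    ⟨σ w, ⟨hw.1, (mem_frontier_iff_graphFun_eq_zero hΩ he hg hU h hw.2).2 (hFσ w)⟩, hπσ w⟩
  have hle := W.lipschitzWith_orthogonalProjectionOnto.hausdorffMeasure_image_le hd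
    (N ∩ frontier Ω)
  intro h0
  rw [h0, mul_zero] at hle
  exact (hpos.trans_le (measure_mono hsub)).not_ge hle

/-- The part of a compact set in a layer of thickness `1 / n` below a graph has volume `O(1/n)`,
because `n` disjoint translates of it lie in a fixed ball. -/
theorem exists_volume_layer_le (he : ‖e‖ = 1) (hg : Continuous g) {K : Set E} (hK : IsCompact K) :
    ∃ C : ℝ, 0 ≤ C ∧ ∀ n : ℕ, 0 < n →
      n * volume.real (K ∩ {y | -2 < n * graphFun e g y ∧ n * graphFun e g y < -1}) ≤ C := by
  obtain ⟨R, hR⟩ := hK.isBounded.subset_ball (0 : E)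
  refine ⟨volume.real (Metric.ball (0 : E) (R + 1)), measureReal_nonneg, fun n hn => ?_⟩
  have hn' : (0 : ℝ) < n := by exact_mod_cast hn
  have hF : Continuous (graphFun e g) := by
    unfold graphFun
    fun_prop
  set T := K ∩ {y | -2 < n * graphFun e g y ∧ n * graphFun e g y < -1} with hT
  have hTm : MeasurableSet T := by
    refine hK.measurableSet.inter (IsOpen.measurableSet ?_)
    have hnF : Continuous fun y => (n : ℝ) * graphFun e g y := by fun_prop
    exact (isOpen_lt continuous_const hnF).inter (isOpen_lt hnF continuous_const)
  -- `τ k` is `T` moved up by `k / n`. There `n F` lies in `(k - 2, k - 1)`, which makes the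
  -- translates disjoint; for `k < n` the shift is at most `1`.
  let τ : ℕ → Set E := fun k => (fun y => y + (-((k : ℝ) / n) • e)) ⁻¹' T
  have hτm : ∀ k, MeasurableSet (τ k) := fun k => hTm.preimage (by fun_prop)
  have hτv : ∀ k, volume (τ k) = volume T := fun k => measure_preimage_add_right _ _ _
  have hτF : ∀ k, ∀ y ∈ τ k, -2 + k < n * graphFun e g y ∧ n * graphFun e g y < -1 + k := by
    intro k y hy
    have h := hy.2
    simp only [mem_ofPred_eq, graphFun_add_smul he] at h
    have h2 : (n : ℝ) * (graphFun e g y + -((k : ℝ) / n)) = n * graphFun e g y - k := by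
      field_simp
      ring
    rw [h2] at h
    constructor <;> linarith [h.1, h.2]
  have hdisj : (↑(Finset.range n) : Set ℕ).PairwiseDisjoint τ := by
    intro j _ k _ hjk
    refine disjoint_left.2 fun y hy hy' => hjk ?_
    have h1 := hτF j y hy
    have h2 := hτF k y hy'
    have h3 : (j : ℝ) < k + 1 := by linarith [h1.1, h2.2]
    have h4 : (k : ℝ) < j + 1 := by linarith [h1.2, h2.1]
    have h3' : j < k + 1 := by exact_mod_cast h3
    have h4' : k < j + 1 := by exact_mod_cast h4
    omega
  have hsub : (⋃ k ∈ Finset.range n, τ k) ⊆ Metric.ball (0 : E) (R + 1) := by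
    intro y hy
    obtain ⟨k, hk, hyk⟩ := mem_iUnion₂.1 hy
    have h1 := hR hyk.1
    rw [mem_ball_zero_iff] at h1 ⊢
    have hk' : (k : ℝ) / n ≤ 1 := by
      rw [div_le_one hn']
      exact_mod_cast (Finset.mem_range.1 hk).le
    have h2 : ‖-((k : ℝ) / n) • e‖ ≤ 1 := by
      rw [norm_smul, he, mul_one, norm_neg, Real.norm_eq_abs, abs_of_nonneg (by positivity)]
      exact hk'
    calc ‖y‖ = ‖(y + -((k : ℝ) / n) • e) - (-((k : ℝ) / n) • e)‖ := by rw [add_sub_cancel_right]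
      _ ≤ ‖y + -((k : ℝ) / n) • e‖ + ‖-((k : ℝ) / n) • e‖ := norm_sub_le _ _
      _ < R + 1 := by linarith
  have hle := measure_mono (μ := volume) hsub
  rw [measure_biUnion_finset hdisj fun k _ => hτm k] at hle
  simp only [hτv, Finset.sum_const, Finset.card_range, nsmul_eq_mul] at hle
  have := ENNReal.toReal_mono measure_ball_lt_top.ne hle
  rwa [ENNReal.toReal_mul, ENNReal.toReal_natCast] at this

theorem inner_gradient (f : E → ℝ) (x v : E) : (inner ℝ (∇ f x) v : ℝ) = fderiv ℝ f x v :=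
  InnerProductSpace.toDual_symm_apply

/-- A positive value would persist, by continuity, on a relatively open piece of the graph. That
piece has positive surface measure, and the normalized `∇F` is an outward normal at each of its
points, which contradicts the almost everywhere sign condition. The compactness argument below needs
the sign at every point. -/
theorem fderiv_graphFun_apply_nonpos {V : E → E} (hΩ : IsOpen Ω)
    (hV : ContinuousOn V (closure Ω \ D))
    (hflux : ∀ᵐ x ∂(μH[(d : ℝ) - 1] : Measure E), x ∈ frontier Ω \ D →
      ∀ ν, IsOutwardNormalAt Ω x ν → (inner ℝ ν (V x) : ℝ) ≤ 0)
    (he : ‖e‖ = 1) (hg : ContDiff ℝ 1 g) {U : Set E} (hU : IsOpen U)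
    (h : ∀ y ∈ U, y ∈ Ω ↔ graphFun e g y < 0) {O : Set E} (hO : IsOpen O) (hOD : Disjoint O D)
    {y : E} (hy : y ∈ U) (hyO : y ∈ O) (hyf : y ∈ frontier Ω) :
    fderiv ℝ (graphFun e g) y (V y) ≤ 0 := by
  by_contra! hpos
  have hc : ContinuousOn (fun y => fderiv ℝ (graphFun e g) y (V y)) (closure Ω \ D) :=
    ((contDiff_graphFun hg).continuous_fderiv one_ne_zero).continuousOn.clm_apply hV
  have hyD : y ∉ D := fun hD => hOD.le_bot ⟨hyO, hD⟩
  have hev : {z | z ∈ closure Ω \ D → 0 < fderiv ℝ (graphFun e g) z (V z)} ∈ 𝓝 y :=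
    eventually_nhdsWithin_iff.1
      ((hc y ⟨frontier_subset_closure hyf, hyD⟩).eventually (lt_mem_nhds hpos))
  refine hausdorffMeasure_inter_frontier_ne_zero hΩ he hg.continuous hU h hy hyf
    (inter_mem hev (inter_mem (hU.mem_nhds hy) (hO.mem_nhds hyO))) (measure_mono_null ?_ hflux)
  rintro z ⟨⟨hz, hzU, hzO⟩, hzf⟩ hcon
  have hzD : z ∉ D := fun hD => hOD.le_bot ⟨hzO, hD⟩
  have hzpos := hz ⟨frontier_subset_closure hzf, hzD⟩
  have h1 := hcon ⟨hzf, hzD⟩ _ ⟨e, g, hg, ⟨hzf, he, mem_of_superset (hU.mem_nhds hzU) h⟩,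
    rfl⟩
  rw [inner_smul_left, inner_gradient] at h1
  have hgrad : 0 < ‖∇ (graphFun e g) z‖ := by
    refine norm_pos_iff.2 fun h0 => ?_
    rw [← inner_gradient, h0, inner_zero_left] at hzpos
    exact lt_irrefl _ hzpos
  have h2 : 0 < ‖∇ (graphFun e g) z‖⁻¹ * fderiv ℝ (graphFun e g) z (V z) := by positivity
  exact h2.not_ge h1

end Graph

/-! ### Flux inequality near `C¹` boundary points -/

section Boundary

variable {d : ℕ}

local notation "E" => EuclideanSpace ℝ (Fin d)

variable {Ω D : Set (EuclideanSpace ℝ (Fin d))} {e : EuclideanSpace ℝ (Fin d)}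
  {g : EuclideanSpace ℝ (Fin d) → ℝ}

theorem IsNonnegTest.mul {Ψ η : E → ℝ} (hΨ : IsNonnegTest D Ψ) (hη : ContDiff ℝ 1 η)
    (h0 : ∀ x, 0 ≤ η x) : IsNonnegTest D (fun x => Ψ x * η x) where
  contDiff := hΨ.contDiff.mul hη
  nonneg x := mul_nonneg (hΨ.nonneg x) (h0 x)
  hasCompactSupport := hΨ.hasCompactSupport.mul_right
  disjoint := hΨ.disjoint.mono_left (closure_mono (Function.support_mul_subset_left _ _))

/-- The flux inequality for the product of a test function and a cutoff. -/
theorem IsNonnegTest.integral_mul_add_integral_mul_le {V : E → E}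
    (hV : ∀ i, IsAbsCont Ω D (fun x => V x i)) (hΩ : IsOpen Ω) {Ψ η : E → ℝ}
    (hΨ : IsNonnegTest D Ψ) (hη : ContDiff ℝ 1 η) (hflux : FluxIneq Ω V (fun x => Ψ x * η x)) :
    (∫ x in Ω, divergence V x * Ψ x * η x) + (∫ x in Ω, fderiv ℝ Ψ x (V x) * η x) ≤
      - ∫ x in Ω, Ψ x * fderiv ℝ η x (V x) := by
  have hfd : ∀ x, fderiv ℝ (fun x => Ψ x * η x) x (V x) =
      fderiv ℝ Ψ x (V x) * η x + Ψ x * fderiv ℝ η x (V x) := by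
    intro x
    rw [fderiv_fun_mul (hΨ.contDiff.differentiable one_ne_zero x)
      (hη.differentiable one_ne_zero x)]
    simp only [add_apply, smul_apply, smul_eq_mul]
    ring
  have h1 : IntegrableOn (fun x => fderiv ℝ Ψ x (V x) * η x) Ω :=
    integrableOn_of_continuousOn_of_eq_zero
      ((continuousOn_fderiv_apply hV hΨ.contDiff).mul hη.continuous.continuousOn) hΩ
      hΨ.hasCompactSupport hΨ.disjoint fun x hx => by
        rw [fderiv_eq_zero_of_notMem_tsupport hx]; exact zero_mul _
  have h2 : IntegrableOn (fun x => Ψ x * fderiv ℝ η x (V x)) Ω :=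
    integrableOn_of_continuousOn_of_eq_zero
      (hΨ.contDiff.continuous.continuousOn.mul (continuousOn_fderiv_apply hV hη)) hΩ
      hΨ.hasCompactSupport hΨ.disjoint fun x hx => by
        rw [image_eq_zero_of_notMem_tsupport hx, zero_mul]
  simp only [FluxIneq, hfd, ← mul_assoc] at hflux
  rw [integral_add h1 h2] at hflux
  linarith

/-- The flux inequality follows if it holds up to `ε` for cutoffs which converge to `1` in `Ω`. -/
theorem IsNonnegTest.fluxIneq_of_tendsto {V : E → E}
    (hV : ∀ i, IsAbsCont Ω D (fun x => V x i)) (hΩ : IsOpen Ω) {Ψ : E → ℝ}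
    (hΨ : IsNonnegTest D Ψ) {η : ℕ → E → ℝ} (hη : ∀ n, ContDiff ℝ 1 (η n))
    (h0 : ∀ n x, 0 ≤ η n x) (h1 : ∀ n x, η n x ≤ 1)
    (hlim : ∀ x ∈ Ω, x ∈ tsupport Ψ → Tendsto (fun n => η n x) atTop (𝓝 1))
    (hflux : ∀ n, FluxIneq Ω V (fun x => Ψ x * η n x))
    (herr : ∀ ε > 0, ∀ᶠ n in atTop, - ∫ x in Ω, Ψ x * fderiv ℝ (η n) x (V x) ≤ ε) :
    FluxIneq Ω V Ψ := by
  have hb : ∀ n x, |η n x| ≤ 1 := fun n x => by rw [abs_of_nonneg (h0 n x)]; exact h1 n x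
  have hm : ∀ n, AEStronglyMeasurable (η n) (volume.restrict Ω) := fun n =>
    (hη n).continuous.aestronglyMeasurable
  have t1 := tendsto_integral_mul_cutoff (hΨ.integrableOn_divergence_mul hV hΩ) hm hb (by
    filter_upwards [self_mem_ae_restrict hΩ.measurableSet] with x hx hne
    refine hlim x hx (by_contra fun hn => hne ?_)
    rw [image_eq_zero_of_notMem_tsupport hn, mul_zero])
  have t2 := tendsto_integral_mul_cutoff (hΨ.integrableOn_fderiv_apply hV hΩ) hm hb (by
    filter_upwards [self_mem_ae_restrict hΩ.measurableSet] with x hx hne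
    refine hlim x hx (by_contra fun hn => hne ?_)
    rw [fderiv_eq_zero_of_notMem_tsupport hn]; rfl)
  have key : (∫ x in Ω, divergence V x * Ψ x) + (∫ x in Ω, fderiv ℝ Ψ x (V x)) ≤ 0 := by
    refine le_of_forall_pos_le_add fun ε hε => ?_
    rw [zero_add]
    refine le_of_tendsto (t1.add t2) ?_
    filter_upwards [herr ε hε] with n hn
    exact (hΨ.integral_mul_add_integral_mul_le hV hΩ (hη n) (hflux n)).trans hn
  rw [FluxIneq]
  linarith

/-- With `F` the graph function and `G = Ψ ∇F · V`, the cutoff `η n` turns the error into `(n+1) ∫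
st'(-1 - (n+1)F) G`. The integrand lives in the layer `-2 < (n+1)F < -1`, of volume at most `C /
(n+1)`. Since `0 ≤ st' ≤ M`, an upper bound `G ≤ δ` near the boundary makes the error at most `M C
δ`. -/
theorem exists_isOpen_fluxIneq_of_isOutwardNormalAt {V : E → E} (hΩ : IsOpen Ω)
    (hD : D ⊆ frontier Ω) (hV : ∀ i, IsAbsCont Ω D (fun x => V x i))
    (hflux : ∀ᵐ x ∂(μH[(d : ℝ) - 1] : Measure E), x ∈ frontier Ω \ D →
      ∀ ν, IsOutwardNormalAt Ω x ν → (inner ℝ ν (V x) : ℝ) ≤ 0)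
    {x₀ ν₀ : E} (hx₀ : IsOutwardNormalAt Ω x₀ ν₀) :
    ∃ U, IsOpen U ∧ x₀ ∈ U ∧ ∀ Ψ, IsNonnegTest D Ψ → tsupport Ψ ⊆ U → FluxIneq Ω V Ψ := by
  obtain ⟨e, g, hg, ⟨-, he, hev⟩, -⟩ := hx₀
  obtain ⟨U, hU, hUo, hxU⟩ := eventually_nhds_iff.1 hev
  refine ⟨U, hUo, hxU, fun Ψ hΨ hΨU => ?_⟩
  have hVc : ContinuousOn V (closure Ω \ D) := continuousOn_of_components fun i => (hV i).continuousOn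
  have hFd : ContDiff ℝ 1 (graphFun e g) := contDiff_graphFun hg
  set F := graphFun e g with hF
  have hFc : Continuous F := hFd.continuous
  set st := Real.smoothTransition with hst
  obtain ⟨M, hM0, hst0, hstM, hstl, hstr⟩ := smoothTransition_deriv_bound
  obtain ⟨C, hC0, hC⟩ := exists_volume_layer_le he hg.continuous hΨ.hasCompactSupport.isCompact
  let G : E → ℝ := fun x => Ψ x * fderiv ℝ F x (V x)
  have hGc : ContinuousOn G (closure Ω \ D) :=
    hΨ.contDiff.continuous.continuousOn.mul (continuousOn_fderiv_apply hV hFd)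
  have hG0 : ∀ y ∈ frontier Ω, y ∈ tsupport Ψ → G y ≤ 0 := by
    intro y hyf hyt
    by_cases hy0 : Ψ y = 0
    · simp [G, hy0]
    -- The open support, rather than its closure, provides a neighbourhood of `y` disjoint from `D`.
    · have hO : IsOpen (Function.support Ψ) := hΨ.contDiff.continuous.isOpen_support
      exact mul_nonpos_of_nonneg_of_nonpos (hΨ.nonneg y)
        (fderiv_graphFun_apply_nonpos hΩ hVc hflux he hg hUo hU hO
          (hΨ.disjoint.mono_left subset_closure) (hΨU hyt) hy0 hyf)
  let η : ℕ → E → ℝ := fun n x => st (-1 - (n + 1 : ℕ) * F x)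
  have hη : ∀ n, ContDiff ℝ 1 (η n) := fun n =>
    (Real.smoothTransition.contDiff (n := 1)).comp (contDiff_const.sub (contDiff_const.mul hFd))
  have hηd : ∀ n x v, fderiv ℝ (η n) x v =
      deriv st (-1 - (n + 1 : ℕ) * F x) * (-((n + 1 : ℕ) * fderiv ℝ F x v)) := by
    intro n x v
    have h1 : HasFDerivAt (fun x => -1 - (n + 1 : ℕ) * F x)
        (-(((n + 1 : ℕ) : ℝ) • fderiv ℝ F x)) x := by
      exact ((hFd.differentiable one_ne_zero x).hasFDerivAt.const_mul _).const_sub _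
    have h2 : HasDerivAt st (deriv st (-1 - (n + 1 : ℕ) * F x)) (-1 - (n + 1 : ℕ) * F x) :=
      ((Real.smoothTransition.contDiff (n := 1)).differentiable one_ne_zero _).hasDerivAt
    have h3 := (h2.comp_hasFDerivAt x h1).fderiv
    change fderiv ℝ (st ∘ fun x => -1 - (n + 1 : ℕ) * F x) x v = _
    rw [h3]
    simp
  have hΩF : ∀ x ∈ Ω, x ∈ tsupport Ψ → F x < 0 := fun x hx hxt => (hU x (hΨU hxt)).1 hx
  refine hΨ.fluxIneq_of_tendsto hV hΩ hη (fun n x => Real.smoothTransition.nonneg _)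
    (fun n x => Real.smoothTransition.le_one _) ?_ ?_ ?_
  · intro x hx hxt
    have hFx := hΩF x hx hxt
    obtain ⟨N, hN⟩ := exists_nat_gt (2 / (-F x))
    refine tendsto_const_nhds.congr' ?_
    filter_upwards [eventually_ge_atTop N] with n hn
    refine (Real.smoothTransition.one_of_one_le ?_).symm
    rw [div_lt_iff₀ (by linarith)] at hN
    have h1 : (N : ℝ) ≤ (n + 1 : ℕ) := by exact_mod_cast hn.trans (Nat.le_succ n)
    nlinarith
  · intro n
    refine (hΨ.mul (hη n) fun x => Real.smoothTransition.nonneg _).fluxIneq_of_subset hV hΩ hD ?_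
    have hn : (0 : ℝ) < (n + 1 : ℕ) := by positivity
    -- The closure of the support of `Ψ η_n` stays in `(n+1) F ≤ -1`, hence inside `Ω`, so the
    -- interior case applies.
    have hcl : IsClosed (tsupport Ψ ∩ {x | (n + 1 : ℕ) * F x ≤ -1}) :=
      (isClosed_tsupport Ψ).inter (isClosed_le (by fun_prop) continuous_const)
    refine (closure_minimal (fun x hx => ?_) hcl).trans fun x hx => ?_
    · rw [Function.mem_support] at hx
      refine ⟨subset_tsupport Ψ (left_ne_zero_of_mul hx), ?_⟩
      by_contra hlt
      refine right_ne_zero_of_mul hx (Real.smoothTransition.zero_of_nonpos ?_)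
      rw [mem_ofPred_eq, not_le] at hlt
      linarith
    · refine (hU x (hΨU hx.1)).2 ?_
      have h1 : ((n + 1 : ℕ) : ℝ) * F x ≤ -1 := hx.2
      by_contra! hge
      have := mul_nonneg hn.le hge
      linarith
  · intro ε hε
    set δ : ℝ := ε / (M * C + 1) with hδ
    have hMC : 0 ≤ M * C := mul_nonneg hM0 hC0
    have hδ0 : 0 < δ := by positivity
    have hδε : M * C * δ ≤ ε := by
      rw [hδ, mul_div_assoc', div_le_iff₀ (by positivity)]
      nlinarith
    -- The compact set where `G ≥ δ` misses the boundary, on which `G ≤ 0`. So `F` has a negative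
    -- maximum there, and `G ≤ δ` at all points of `Ω` in the support where `F` exceeds that
    -- maximum.
    have hc : ∃ c > 0, ∀ x ∈ Ω, x ∈ tsupport Ψ → -c < F x → G x ≤ δ := by
      set Kδ := (closure Ω ∩ tsupport Ψ) ∩ G ⁻¹' Ici δ with hKδ
      have hKc : IsCompact Kδ := by
        refine (hΨ.hasCompactSupport.isCompact.inter_left isClosed_closure).of_isClosed_subset ?_
          inter_subset_left
        exact (hGc.mono (closure_inter_subset_of_disjoint hΨ.disjoint)).preimage_isClosed_of_isClosed
          (isClosed_closure.inter (isClosed_tsupport Ψ)) isClosed_Ici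
      have hneg : ∀ x ∈ Kδ, F x < 0 := by
        rintro x ⟨⟨hxc, hxt⟩, hxG⟩
        refine hΩF x (by_contra fun hxn => ?_) hxt
        have h1 : G x ≤ 0 := hG0 x (by rw [hΩ.frontier_eq]; exact ⟨hxc, hxn⟩) hxt
        exact absurd (hδ0.trans_le hxG) h1.not_gt
      rcases Kδ.eq_empty_or_nonempty with hemp | hne
      · refine ⟨1, one_pos, fun x hx hxt _ => ?_⟩
        by_contra! hlt
        have : x ∈ Kδ := ⟨⟨subset_closure hx, hxt⟩, hlt.le⟩
        rw [hemp] at this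
        exact this
      · obtain ⟨x₁, hx₁, hmax⟩ := hKc.exists_isMaxOn hne hFc.continuousOn
        refine ⟨-F x₁, neg_pos.2 (hneg x₁ hx₁), fun x hx hxt hlt => ?_⟩
        by_contra! hlt'
        have : F x ≤ F x₁ := hmax (⟨⟨subset_closure hx, hxt⟩, hlt'.le⟩ : x ∈ Kδ)
        linarith
    obtain ⟨c, hc0, hc⟩ := hc
    obtain ⟨N, hN⟩ := exists_nat_gt (2 / c)
    filter_upwards [eventually_ge_atTop N] with n hn
    have hnN : (N : ℝ) ≤ (n + 1 : ℕ) := by exact_mod_cast hn.trans (Nat.le_succ n)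
    have hCn := hC (n + 1) n.succ_pos
    set m : ℝ := ((n + 1 : ℕ) : ℝ) with hm
    have hm0 : 0 < m := by positivity
    set T := tsupport Ψ ∩ {y | -2 < m * graphFun e g y ∧ m * graphFun e g y < -1} with hT
    have hTm : MeasurableSet T := by
      refine (isClosed_tsupport Ψ).measurableSet.inter (IsOpen.measurableSet ?_)
      have hnF : Continuous fun y => m * F y := by fun_prop
      exact (isOpen_lt continuous_const hnF).inter (isOpen_lt hnF continuous_const)
    have hTfin : volume T ≠ ⊤ :=
      ((measure_mono inter_subset_left).trans_lt
        hΨ.hasCompactSupport.isCompact.measure_lt_top).ne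
    have hpt : ∀ x ∈ Ω, - (Ψ x * fderiv ℝ (η n) x (V x)) ≤ T.indicator (fun _ => m * M * δ) x := by
      intro x hx
      have hrew : - (Ψ x * fderiv ℝ (η n) x (V x)) = m * (deriv st (-1 - m * F x) * G x) := by
        rw [hηd]; simp only [G]; ring
      rw [hrew]
      by_cases hxT : x ∈ T
      · rw [indicator_of_mem hxT]
        have hFx : -c < F x := by
          have h1 : -2 < m * F x := hxT.2.1
          rw [div_lt_iff₀ hc0] at hN
          by_contra! hle
          nlinarith
        have hGx := hc x hx hxT.1 hFx
        have h1 : deriv st (-1 - m * F x) * G x ≤ M * δ :=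
          (mul_le_mul_of_nonneg_left hGx (hst0 _)).trans
            (mul_le_mul_of_nonneg_right (hstM _) hδ0.le)
        rw [mul_assoc]
        exact mul_le_mul_of_nonneg_left h1 hm0.le
      · rw [indicator_of_notMem hxT]
        by_cases hxt : x ∈ tsupport Ψ
        · have : deriv st (-1 - m * F x) = 0 := by
            by_cases h1 : -2 < m * F x
            · have h2 : -1 ≤ m * F x := by
                by_contra! hlt
                exact hxT ⟨hxt, h1, hlt⟩
              exact hstl _ (by linarith)
            · exact hstr _ (by linarith)
          simp [this]
        · simp [G, image_eq_zero_of_notMem_tsupport hxt]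
    have hint : Integrable (T.indicator fun _ => m * M * δ) :=
      (integrable_indicator_iff hTm).2 (integrableOn_const hTfin)
    rw [← integral_neg]
    calc ∫ x in Ω, - (Ψ x * fderiv ℝ (η n) x (V x))
        ≤ ∫ x in Ω, T.indicator (fun _ => m * M * δ) x := by
          refine setIntegral_mono_on ?_ hint.integrableOn hΩ.measurableSet hpt
          refine (integrableOn_of_continuousOn_of_eq_zero
            (hΨ.contDiff.continuous.continuousOn.mul (continuousOn_fderiv_apply hV (hη n))) hΩ
            hΨ.hasCompactSupport hΨ.disjoint fun x hx => ?_).neg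
          simp [image_eq_zero_of_notMem_tsupport hx]
      _ ≤ ∫ x, T.indicator (fun _ => m * M * δ) x :=
          setIntegral_le_integral hint (Eventually.of_forall fun x =>
            indicator_nonneg (fun _ _ => by positivity) x)
      _ = M * δ * (m * volume.real T) := by
          rw [integral_indicator hTm, setIntegral_const, smul_eq_mul]; ring
      _ ≤ M * δ * C := mul_le_mul_of_nonneg_left hCn (by positivity)
      _ ≤ ε := by linarith

/-- The flux inequality for test functions which do not meet the singular part of the boundary. -/
theorem IsNonnegTest.fluxIneq_of_forall_exists_normal {V : E → E} (hΩ : IsOpen Ω)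
    (hD : D ⊆ frontier Ω) (hV : ∀ i, IsAbsCont Ω D (fun x => V x i))
    (hflux : ∀ᵐ x ∂(μH[(d : ℝ) - 1] : Measure E), x ∈ frontier Ω \ D →
      ∀ ν, IsOutwardNormalAt Ω x ν → (inner ℝ ν (V x) : ℝ) ≤ 0)
    {Ψ : E → ℝ} (hΨ : IsNonnegTest D Ψ)
    (hreg : ∀ x ∈ frontier Ω, x ∈ tsupport Ψ → ∃ ν, IsOutwardNormalAt Ω x ν) :
    FluxIneq Ω V Ψ := by
  refine hΨ.fluxIneq_of_locally hV hΩ fun x hx => ?_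
  by_cases hxΩ : x ∈ Ω
  · exact ⟨Ω, hΩ, hxΩ, fun Φ hΦ hΦU _ => hΦ.fluxIneq_of_subset hV hΩ hD hΦU⟩
  by_cases hxc : x ∈ closure Ω
  · obtain ⟨ν, hν⟩ := hreg x (by rw [hΩ.frontier_eq]; exact ⟨hxc, hxΩ⟩) hx
    obtain ⟨U, hUo, hxU, hU⟩ := exists_isOpen_fluxIneq_of_isOutwardNormalAt hΩ hD hV hflux hν
    exact ⟨U, hUo, hxU, fun Φ hΦ hΦU _ => hU Φ hΦ hΦU⟩
  · refine ⟨(closure Ω)ᶜ, isClosed_closure.isOpen_compl, hxc, fun Φ _ hΦU _ => ?_⟩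
    exact fluxIneq_of_disjoint
      ((disjoint_compl_left.mono_right subset_closure).mono_left hΦU)

end Boundary

/-! ### Products of cutoffs and coverings of null sets -/

/-- In each term of the Leibniz rule the undifferentiated factors lie in `[0, 1]`, so no constant
depending on the number of factors appears. -/
theorem norm_fderiv_prod_le {F ι : Type*} [NormedAddCommGroup F] [NormedSpace ℝ F] (u : Finset ι)
    {c : ι → F → ℝ} (hc : ∀ k ∈ u, Differentiable ℝ (c k)) (h0 : ∀ k ∈ u, ∀ x, 0 ≤ c k x)
    (h1 : ∀ k ∈ u, ∀ x, c k x ≤ 1) (x : F) :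
    ‖fderiv ℝ (fun x => ∏ k ∈ u, c k x) x‖ ≤ ∑ k ∈ u, ‖fderiv ℝ (c k) x‖ := by
  classical
  induction u using Finset.induction_on with
  | empty => simp
  | insert a u ha ih =>
    have hc' : ∀ k ∈ u, Differentiable ℝ (c k) := fun k hk => hc k (Finset.mem_insert_of_mem hk)
    have h0' : ∀ k ∈ u, ∀ x, 0 ≤ c k x := fun k hk => h0 k (Finset.mem_insert_of_mem hk)
    have h1' : ∀ k ∈ u, ∀ x, c k x ≤ 1 := fun k hk => h1 k (Finset.mem_insert_of_mem hk)
    have hd : DifferentiableAt ℝ (fun x => ∏ k ∈ u, c k x) x :=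
      (HasFDerivAt.finsetProd fun k hk => (hc' k hk x).hasFDerivAt).differentiableAt
    simp only [Finset.prod_insert ha, Finset.sum_insert ha]
    rw [fderiv_fun_mul (hc a (Finset.mem_insert_self a u) x) hd]
    refine (norm_add_le _ _).trans ?_
    rw [norm_smul, norm_smul, add_comm]
    have ha0 := h0 a (Finset.mem_insert_self a u) x
    have ha1 := h1 a (Finset.mem_insert_self a u) x
    have hp0 : 0 ≤ ∏ k ∈ u, c k x := Finset.prod_nonneg fun k hk => h0' k hk x
    have hp1 : ∏ k ∈ u, c k x ≤ 1 := Finset.prod_le_one (fun k hk => h0' k hk x) fun k hk => h1' k hk x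
    refine add_le_add ?_ ?_
    · rw [Real.norm_eq_abs, abs_of_nonneg hp0]
      exact mul_le_of_le_one_left (norm_nonneg _) hp1
    · rw [Real.norm_eq_abs, abs_of_nonneg ha0]
      exact (mul_le_of_le_one_left (norm_nonneg _) ha1).trans (ih hc' h0' h1')

/-- A compact set of vanishing `s`-dimensional Hausdorff measure is covered by finitely many
balls for which the sum of the `s`-th powers of the radii is small. -/
theorem IsCompact.exists_finset_ball_cover {X : Type*} [MetricSpace X] [MeasurableSpace X]
    [BorelSpace X] {S : Set X} (hS : IsCompact S) (hne : S.Nonempty) {s : ℝ} (hs : 0 ≤ s)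
    (h0 : (μH[s] : Measure X) S = 0) {ε : ℝ} (hε : 0 < ε) :
    ∃ (u : Finset ℕ) (x : ℕ → X) (r : ℕ → ℝ), (∀ k ∈ u, x k ∈ S) ∧ (∀ k ∈ u, 0 < r k ∧ r k ≤ ε) ∧
      (S ⊆ ⋃ k ∈ u, Metric.ball (x k) (r k)) ∧ ∑ k ∈ u, r k ^ s ≤ ε := by
  have hε2 : 0 < ENNReal.ofReal (ε / 2) := ENNReal.ofReal_pos.2 (by linarith)
  rw [Measure.hausdorffMeasure_apply] at h0
  have h1 := le_antisymm (le_iSup₂_of_le (ENNReal.ofReal (ε / 2)) hε2 le_rfl |>.trans h0.le) zero_le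
  have h2 := h1.trans_lt hε2
  simp only [iInf_lt_iff] at h2
  obtain ⟨t, htS, htd, htsum⟩ := h2
  have hfin : ∀ n, Metric.ediam (t n) ≠ ⊤ := fun n => ((htd n).trans_lt ENNReal.ofReal_lt_top).ne
  set a : ℕ → ℝ := fun n => (Metric.ediam (t n)).toReal with ha
  have ha0 : ∀ n, 0 ≤ a n := fun n => ENNReal.toReal_nonneg
  have haε : ∀ n, a n ≤ ε / 2 := fun n => by
    have := ENNReal.toReal_mono ENNReal.ofReal_ne_top (htd n)
    rwa [ENNReal.toReal_ofReal (by linarith)] at this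
  -- The radius exceeds the diameter strictly, so that an open ball centred in `t n` contains `t n`
  -- even if the diameter is `0`. The surplus terms sum to `ε / 2`.
  have hr : ∀ n : ℕ, ∃ r, a n < r ∧ r ≤ ε ∧ r ^ s ≤ a n ^ s + ε / 2 / 2 / 2 ^ n := by
    intro n
    have hc : ContinuousAt (fun x : ℝ => x ^ s) (a n) :=
      Real.continuousAt_rpow_const _ _ (Or.inr hs)
    have hlt : a n ^ s < a n ^ s + ε / 2 / 2 / 2 ^ n := by
      have : 0 < ε / 2 / 2 / 2 ^ n := by positivity
      linarith
    have e1 : ∀ᶠ r in 𝓝[>] (a n), r ^ s < a n ^ s + ε / 2 / 2 / 2 ^ n :=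
      (hc.eventually (gt_mem_nhds hlt)).filter_mono nhdsWithin_le_nhds
    have e2 : ∀ᶠ r in 𝓝[>] (a n), r < ε :=
      (gt_mem_nhds (by linarith [haε n] : a n < ε)).filter_mono nhdsWithin_le_nhds
    obtain ⟨r, ⟨hr1, hr2⟩, hr3⟩ := ((e1.and e2).and self_mem_nhdsWithin).exists
    exact ⟨r, hr3, hr2.le, hr1.le⟩
  choose r har hrε hrs using hr
  have hx : ∀ n, ∃ x : X, (t n ∩ S).Nonempty → x ∈ t n ∩ S := by
    intro n
    by_cases h : (t n ∩ S).Nonempty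
    · exact ⟨h.some, fun _ => h.some_mem⟩
    · exact ⟨hne.some, fun h' => absurd h' h⟩
  choose x hx using hx
  -- Only pieces meeting `S` are kept: they can be centred in `S`, and their being nonempty makes
  -- `ediam ^ s` count in the Hausdorff sum.
  set N : Set ℕ := {n | (t n ∩ S).Nonempty} with hN
  have hsub : ∀ n ∈ N, t n ⊆ Metric.ball (x n) (r n) := by
    intro n hn y hy
    have h3 := Metric.edist_le_ediam_of_mem hy (hx n hn).1
    have h4 := ENNReal.toReal_mono (hfin n) h3
    rw [← dist_edist] at h4
    exact h4.trans_lt (har n)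
  have hcov : S ⊆ ⋃ n : N, Metric.ball (x n) (r n) := by
    intro y hy
    obtain ⟨n, hn⟩ := mem_iUnion.1 (htS hy)
    have hnN : n ∈ N := ⟨y, hn, hy⟩
    exact mem_iUnion.2 ⟨⟨n, hnN⟩, hsub n hnN hn⟩
  obtain ⟨v, hv⟩ := hS.elim_finite_subcover (fun n : N => Metric.ball (x n) (r n))
    (fun _ => Metric.isOpen_ball) hcov
  have huN : ∀ k ∈ v.map (Function.Embedding.subtype _), k ∈ N := by
    intro k hk
    obtain ⟨⟨n, hn⟩, _, rfl⟩ := Finset.mem_map.1 hk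
    exact hn
  refine ⟨v.map (Function.Embedding.subtype _), x, r, fun k hk => (hx k (huN k hk)).2,
    fun k _ => ⟨(ha0 k).trans_lt (har k), hrε k⟩, ?_, ?_⟩
  · intro y hy
    obtain ⟨n, hn, hyn⟩ := mem_iUnion₂.1 (hv hy)
    exact mem_iUnion₂.2 ⟨n, Finset.mem_map_of_mem _ hn, hyn⟩
  · set u := v.map (Function.Embedding.subtype _) with hu
    have hsum1 : ∑ k ∈ u, a k ^ s ≤ ε / 2 := by
      have h3 : ∑ k ∈ u, Metric.ediam (t k) ^ s ≤ ENNReal.ofReal (ε / 2) := by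
        refine le_trans ?_ ((ENNReal.sum_le_tsum u).trans htsum.le)
        refine Finset.sum_le_sum fun k hk => ?_
        exact le_iSup_of_le ((huN k hk).mono inter_subset_left) le_rfl
      have h4 := ENNReal.toReal_mono ENNReal.ofReal_ne_top h3
      rw [ENNReal.toReal_ofReal (by linarith),
        ENNReal.toReal_sum fun k _ => ENNReal.rpow_ne_top_of_nonneg hs (hfin k)] at h4
      simpa only [ha, ENNReal.toReal_rpow] using h4
    have hsum2 : ∑ k ∈ u, ε / 2 / 2 / 2 ^ k ≤ ε / 2 :=
      sum_le_hasSum u (fun k _ => by positivity) (hasSum_geometric_two' (ε / 2))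
    calc ∑ k ∈ u, r k ^ s ≤ ∑ k ∈ u, (a k ^ s + ε / 2 / 2 / 2 ^ k) :=
          Finset.sum_le_sum fun k _ => hrs k
      _ ≤ ε := by rw [Finset.sum_add_distrib]; linarith

/-! ### Removing the singular part of the boundary -/

section SingularSet

variable {d : ℕ}

local notation "E" => EuclideanSpace ℝ (Fin d)

variable {Ω D : Set (EuclideanSpace ℝ (Fin d))}

/-- A cutoff function vanishing on the ball of radius `r` and equal to `1` off the ball of
radius `2 r`, with gradient of order `1 / r`. -/
theorem exists_ball_cutoff_bound (d : ℕ) :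
    ∃ M : ℝ, 0 ≤ M ∧ ∀ (x₀ : EuclideanSpace ℝ (Fin d)) (r : ℝ), 0 < r →
      ∃ c : EuclideanSpace ℝ (Fin d) → ℝ, ContDiff ℝ 1 c ∧ (∀ x, 0 ≤ c x) ∧ (∀ x, c x ≤ 1) ∧
        (∀ x ∈ Metric.ball x₀ r, c x = 0) ∧ (∀ x ∉ Metric.closedBall x₀ (2 * r), c x = 1) ∧
        ∀ x, ‖fderiv ℝ c x‖ ≤ (Metric.closedBall x₀ (2 * r)).indicator (fun _ => M / r) x := by
  let B : ContDiffBump (0 : EuclideanSpace ℝ (Fin d)) := ⟨1, 2, one_pos, one_lt_two⟩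
  have hB : ContDiff ℝ 1 B := B.contDiff
  obtain ⟨M, hM⟩ := (B.hasCompactSupport.fderiv (𝕜 := ℝ)).exists_bound_of_continuous
    (hB.continuous_fderiv one_ne_zero)
  have hM0 : 0 ≤ M := (norm_nonneg _).trans (hM 0)
  refine ⟨M, hM0, fun x₀ r hr => ?_⟩
  have hout : ∀ x ∉ Metric.closedBall x₀ (2 * r), r⁻¹ • (x - x₀) ∉ tsupport B := by
    intro x hx h
    rw [B.tsupport_eq, mem_closedBall_zero_iff, norm_smul, norm_inv, Real.norm_eq_abs,
      abs_of_pos hr, ← dist_eq_norm, inv_mul_le_iff₀ hr] at h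
    exact hx (Metric.mem_closedBall.2 (h.trans_eq (mul_comm _ _)))
  refine ⟨fun x => 1 - B (r⁻¹ • (x - x₀)), ?_, ?_, ?_, ?_, ?_, ?_⟩
  · have : ContDiff ℝ 1 fun x : EuclideanSpace ℝ (Fin d) => r⁻¹ • (x - x₀) := by fun_prop
    exact contDiff_const.sub (hB.comp this)
  · exact fun x => sub_nonneg.2 B.le_one
  · exact fun x => sub_le_self _ B.nonneg
  · intro x hx
    have : r⁻¹ • (x - x₀) ∈ Metric.closedBall (0 : EuclideanSpace ℝ (Fin d)) 1 := by
      rw [mem_closedBall_zero_iff, norm_smul, norm_inv, Real.norm_eq_abs, abs_of_pos hr,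
        ← dist_eq_norm, inv_mul_le_iff₀ hr, mul_one]
      exact (Metric.mem_ball.1 hx).le
    change 1 - B (r⁻¹ • (x - x₀)) = 0
    rw [B.one_of_mem_closedBall this, sub_self]
  · intro x hx
    simp only
    rw [image_eq_zero_of_notMem_tsupport (hout x hx), sub_zero]
  · intro x
    have h1 : HasFDerivAt (fun x : EuclideanSpace ℝ (Fin d) => r⁻¹ • (x - x₀)) (r⁻¹ • ContinuousLinearMap.id ℝ _) x :=
      ((hasFDerivAt_id x).sub_const x₀).const_smul r⁻¹
    have h2 := ((hB.differentiable one_ne_zero _).hasFDerivAt.comp x h1).const_sub 1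
    have h3 : fderiv ℝ (fun x => 1 - B (r⁻¹ • (x - x₀))) x = _ := h2.fderiv
    rw [h3, norm_neg, ContinuousLinearMap.comp_smul, ContinuousLinearMap.comp_id, norm_smul,
      norm_inv, Real.norm_eq_abs, abs_of_pos hr]
    by_cases hx : x ∈ Metric.closedBall x₀ (2 * r)
    · rw [indicator_of_mem hx, div_eq_inv_mul]
      exact mul_le_mul_of_nonneg_left (hM _) (by positivity)
    · rw [indicator_of_notMem hx, fderiv_eq_zero_of_notMem_tsupport (hout x hx), norm_zero, mul_zero]

/-- Cutoff functions around a compact set of vanishing `(d-1)`-dimensional Hausdorff measure, with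
gradients that are small in `L¹`. -/
theorem exists_cutoff_of_hausdorffMeasure_eq_zero {S : Set E} (hS : IsCompact S) (hne : S.Nonempty)
    (hd : d ≠ 0) (h0 : (μH[(d : ℝ) - 1] : Measure E) S = 0) {ε : ℝ} (hε : 0 < ε) :
    ∃ η h : E → ℝ, ContDiff ℝ 1 η ∧ (∀ x, 0 ≤ η x) ∧ (∀ x, η x ≤ 1) ∧
      (∃ O, IsOpen O ∧ S ⊆ O ∧ ∀ x ∈ O, η x = 0) ∧ (∀ x, η x ≠ 1 → ∃ y ∈ S, dist x y ≤ ε) ∧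
      Integrable h ∧ (∀ x, ‖fderiv ℝ η x‖ ≤ h x) ∧ ∫ x, h x ≤ ε := by
  obtain ⟨M, hM0, hM⟩ := exists_ball_cutoff_bound d
  set v : ℝ := volume.real (Metric.closedBall (0 : E) 1) with hv
  have hv0 : 0 ≤ v := measureReal_nonneg
  -- The integral of `M / r` over a ball of radius `2 r` is `A r^{d-1}`.
  set A : ℝ := M * 2 ^ d * v with hA
  have hA0 : 0 ≤ A := by positivity
  have hd1 : (0 : ℝ) ≤ (d : ℝ) - 1 := by
    have : (1 : ℝ) ≤ d := by exact_mod_cast Nat.one_le_iff_ne_zero.2 hd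
    linarith
  -- The bound `ε / 2` keeps the doubled balls within distance `ε` of `S`; the bound `ε / (A + 1)`
  -- makes `A ∑ r^{d-1} ≤ ε`.
  set δ : ℝ := min (ε / 2) (ε / (A + 1)) with hδ
  have hδ0 : 0 < δ := by positivity
  obtain ⟨u, x, r, hxS, hr, hcov, hsum⟩ := hS.exists_finset_ball_cover hne hd1 h0 hδ0
  have hc : ∀ k, ∃ c : E → ℝ, k ∈ u → ContDiff ℝ 1 c ∧ (∀ y, 0 ≤ c y) ∧ (∀ y, c y ≤ 1) ∧
        (∀ y ∈ Metric.ball (x k) (r k), c y = 0) ∧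
        (∀ y ∉ Metric.closedBall (x k) (2 * r k), c y = 1) ∧
        ∀ y, ‖fderiv ℝ c y‖ ≤ (Metric.closedBall (x k) (2 * r k)).indicator (fun _ => M / r k) y := by
    intro k
    by_cases hk : k ∈ u
    · obtain ⟨c, hc⟩ := hM (x k) (r k) (hr k hk).1
      exact ⟨c, fun _ => hc⟩
    · exact ⟨0, fun h => absurd h hk⟩
  choose c hc using hc
  have hint : ∀ k ∈ u, Integrable ((Metric.closedBall (x k) (2 * r k)).indicator
      (fun _ => M / r k)) := fun k _ =>
    (integrable_indicator_iff Metric.isClosed_closedBall.measurableSet).2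
      (integrableOn_const measure_closedBall_lt_top.ne)
  refine ⟨fun y => ∏ k ∈ u, c k y,
    fun y => ∑ k ∈ u, (Metric.closedBall (x k) (2 * r k)).indicator (fun _ => M / r k) y,
    contDiff_prod fun k hk => (hc k hk).1, fun y => Finset.prod_nonneg fun k hk => (hc k hk).2.1 y,
    fun y => Finset.prod_le_one (fun k hk => (hc k hk).2.1 y) fun k hk => (hc k hk).2.2.1 y,
    ⟨⋃ k ∈ u, Metric.ball (x k) (r k), isOpen_biUnion fun _ _ => Metric.isOpen_ball, hcov, ?_⟩,
    ?_, integrable_finsetSum _ hint, ?_, ?_⟩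
  · intro y hy
    obtain ⟨k, hk, hyk⟩ := mem_iUnion₂.1 hy
    exact Finset.prod_eq_zero hk ((hc k hk).2.2.2.1 y hyk)
  · intro y hy
    by_contra! hcon
    refine hy (Finset.prod_eq_one fun k hk => (hc k hk).2.2.2.2.1 y fun hyk => ?_)
    have h1 := hcon (x k) (hxS k hk)
    have h2 := (hr k hk).2.trans (min_le_left _ _)
    linarith [Metric.mem_closedBall.1 hyk]
  · intro y
    refine (norm_fderiv_prod_le u (fun k hk => (hc k hk).1.differentiable one_ne_zero)
      (fun k hk => (hc k hk).2.1) (fun k hk => (hc k hk).2.2.1) y).trans ?_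
    exact Finset.sum_le_sum fun k hk => (hc k hk).2.2.2.2.2 y
  · rw [integral_finsetSum _ hint]
    have hterm : ∀ k ∈ u, ∫ y, (Metric.closedBall (x k) (2 * r k)).indicator (fun _ => M / r k) y =
        A * r k ^ ((d : ℝ) - 1) := by
      intro k hk
      have hrk := (hr k hk).1
      rw [integral_indicator Metric.isClosed_closedBall.measurableSet, setIntegral_const,
        smul_eq_mul, Measure.real, Measure.addHaar_closedBall' _ _ (by positivity),
        ENNReal.toReal_mul, ENNReal.toReal_ofReal (by positivity), finrank_euclideanSpace_fin,
        Real.rpow_sub_one hrk.ne', Real.rpow_natCast, hA, hv, Measure.real, mul_pow]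
      ring
    rw [Finset.sum_congr rfl hterm, ← Finset.mul_sum]
    calc A * ∑ k ∈ u, r k ^ ((d : ℝ) - 1) ≤ A * (ε / (A + 1)) :=
          mul_le_mul_of_nonneg_left (hsum.trans (min_le_right _ _)) hA0
      _ ≤ ε := by
          rw [mul_div_assoc', div_le_iff₀ (by positivity)]
          nlinarith

/-- The same chart serves all nearby boundary points. Hence the singular part of the boundary is
closed. -/
theorem IsOutwardNormalAt.eventually_exists_outwardNormal {x : E} {ν : E} (hx : IsOutwardNormalAt Ω x ν) :
    ∀ᶠ y in 𝓝 x, y ∈ frontier Ω → ∃ ν, IsOutwardNormalAt Ω y ν := by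
  obtain ⟨e, g, hg, ⟨-, he, hev⟩, -⟩ := hx
  filter_upwards [eventually_eventually_nhds.2 hev] with y hy hyf
  exact ⟨_, e, g, hg, ⟨hyf, he, hy⟩, rfl⟩

/-- The divergence theorem with a sign condition: if `V` points into `Ω` along the regular part
of `∂Ω \ D`, then the flux inequality holds for all nonnegative test functions. -/
theorem IsRegularDomain.fluxIneq {V : E → E} (hΩ : IsRegularDomain Ω D)
    (hV : ∀ i, IsAbsCont Ω D (fun x => V x i))
    (hflux : ∀ᵐ x ∂(μH[(d : ℝ) - 1] : Measure E), x ∈ frontier Ω \ D →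
      ∀ ν, IsOutwardNormalAt Ω x ν → (inner ℝ ν (V x) : ℝ) ≤ 0)
    {Ψ : E → ℝ} (hΨ : IsNonnegTest D Ψ) : FluxIneq Ω V Ψ := by
  have hΩo := hΩ.isOpen
  have hD := hΩ.subset_frontier
  set R : Set E := {x | ∃ ν, IsOutwardNormalAt Ω x ν} with hR
  set S : Set E := (frontier Ω ∩ tsupport Ψ) \ R with hS
  rcases S.eq_empty_or_nonempty with hemp | hne
  · refine hΨ.fluxIneq_of_forall_exists_normal hΩo hD hV hflux fun x hxf hxt => ?_
    by_contra hcon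
    have : x ∈ S := ⟨⟨hxf, hxt⟩, hcon⟩
    rw [hemp] at this
    exact this
  have hSf : S ⊆ frontier Ω := fun x hx => hx.1.1
  have hSc : IsClosed S := by
    rw [← isOpen_compl_iff, isOpen_iff_mem_nhds]
    intro x hx
    by_cases hxf : x ∈ frontier Ω ∩ tsupport Ψ
    · have hxR : x ∈ R := by_contra fun h => hx ⟨hxf, h⟩
      obtain ⟨ν, hν⟩ := hxR
      filter_upwards [IsOutwardNormalAt.eventually_exists_outwardNormal hν] with y hy hyS
      exact hyS.2 (hy (hSf hyS))
    · filter_upwards [(isClosed_frontier.inter (isClosed_tsupport Ψ)).isOpen_compl.mem_nhds hxf]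
        with y hy hyS using hy hyS.1
  have hSK : IsCompact S := hΨ.hasCompactSupport.isCompact.of_isClosed_subset hSc
    fun x hx => hx.1.2
  have hS0 : (μH[(d : ℝ) - 1] : Measure E) S = 0 := by
    refine measure_mono_null (fun x hx => ?_) hΩ.ae_C1
    intro hcon
    exact hx.2 (hcon ⟨hSf hx, fun hxD => hΨ.disjoint.le_bot ⟨hx.1.2, hxD⟩⟩)
  -- In dimension zero every set is clopen and has empty frontier. Otherwise the exponent `d - 1` is
  -- nonnegative.
  have hd : d ≠ 0 := by
    rintro rfl
    obtain ⟨x, hx⟩ := hne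
    have := hSf hx
    rw [(isClopen_discrete Ω).frontier_eq] at this
    exact this
  have hex := fun n : ℕ => exists_cutoff_of_hausdorffMeasure_eq_zero hSK hne hd hS0
    (Nat.one_div_pos_of_nat (α := ℝ) (n := n))
  choose η h hηc hη0 hη1 hηO hηS hhint hηh hhε using hex
  have hVc : ContinuousOn V (closure Ω \ D) := continuousOn_of_components fun i => (hV i).continuousOn
  -- `Ψ V` is bounded on `Ω`, so the error is at most this bound times the `L¹` norm of the majorant
  -- of `∇η_n`, which tends to `0`.
  have hbound : ∃ C, ∀ x ∈ closure Ω ∩ tsupport Ψ, ‖Ψ x • V x‖ ≤ C :=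
    (hΨ.hasCompactSupport.isCompact.inter_left isClosed_closure).exists_bound_of_continuousOn
      (hΨ.contDiff.continuous.continuousOn.smul
        (hVc.mono (closure_inter_subset_of_disjoint hΨ.disjoint)))
  obtain ⟨C', hC'⟩ := hbound
  set C := max C' 0 with hC
  have hC0 : 0 ≤ C := le_max_right _ _
  have hpt : ∀ n, ∀ x ∈ Ω, - (Ψ x * fderiv ℝ (η n) x (V x)) ≤ C * h n x := by
    intro n x hx
    have hh0 : 0 ≤ h n x := (norm_nonneg _).trans (hηh n x)
    by_cases hxt : x ∈ tsupport Ψ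
    · have h1 : Ψ x * fderiv ℝ (η n) x (V x) = fderiv ℝ (η n) x (Ψ x • V x) := by simp
      have h2 := (fderiv ℝ (η n) x).le_opNorm (Ψ x • V x)
      have h3 : ‖fderiv ℝ (η n) x‖ * ‖Ψ x • V x‖ ≤ h n x * C :=
        mul_le_mul (hηh n x) ((hC' x ⟨subset_closure hx, hxt⟩).trans (le_max_left _ _))
          (norm_nonneg _) hh0
      rw [h1, mul_comm C]
      exact (neg_le_abs _).trans (h2.trans h3)
    · rw [image_eq_zero_of_notMem_tsupport hxt, zero_mul, neg_zero]
      positivity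
  refine hΨ.fluxIneq_of_tendsto hV hΩo hηc hη0 hη1 (fun x hx _ => ?_) (fun n => ?_)
    fun ε hε => ?_
  · have hxS : x ∉ S := fun hxS => by
      have := hSf hxS
      rw [hΩo.frontier_eq] at this
      exact this.2 hx
    have hpos := (hSc.notMem_iff_infDist_pos hne).1 hxS
    refine tendsto_const_nhds.congr' ?_
    filter_upwards [(tendsto_one_div_add_atTop_nhds_zero_nat (𝕜 := ℝ)).eventually
      (gt_mem_nhds hpos)] with n hn
    by_contra hcon
    obtain ⟨y, hy, hxy⟩ := hηS n x (Ne.symm hcon)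
    exact absurd ((Metric.infDist_le_dist_of_mem hy).trans hxy) hn.not_ge
  -- `η n` vanishes on a neighbourhood of `S`, so every boundary point in the support of `Ψ η_n` is
  -- regular.
  · refine (hΨ.mul (hηc n) (hη0 n)).fluxIneq_of_forall_exists_normal hΩo hD hV hflux
      fun x hxf hxt => ?_
    by_contra hcon
    obtain ⟨O, hO, hSO, hOη⟩ := hηO n
    have hxS : x ∈ S := ⟨⟨hxf, closure_mono (Function.support_mul_subset_left _ _) hxt⟩, hcon⟩
    refine notMem_tsupport_iff_eventuallyEq.2 ?_ hxt
    filter_upwards [hO.mem_nhds (hSO hxS)] with y hy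
    simp [hOη y hy]
  · have hlim : Tendsto (fun n : ℕ => C * (1 / ((n : ℝ) + 1))) atTop (𝓝 0) := by
      simpa using (tendsto_one_div_add_atTop_nhds_zero_nat (𝕜 := ℝ)).const_mul C
    filter_upwards [hlim.eventually (gt_mem_nhds hε)] with n hn
    rw [← integral_neg]
    calc ∫ x in Ω, - (Ψ x * fderiv ℝ (η n) x (V x)) ≤ ∫ x in Ω, C * h n x := by
          refine setIntegral_mono_on ?_ ((hhint n).const_mul C).integrableOn hΩo.measurableSet
            (hpt n)
          refine (integrableOn_of_continuousOn_of_eq_zero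
            (hΨ.contDiff.continuous.continuousOn.mul (continuousOn_fderiv_apply hV (hηc n))) hΩo
            hΨ.hasCompactSupport hΨ.disjoint fun x hx => ?_).neg
          simp [image_eq_zero_of_notMem_tsupport hx]
      _ ≤ ∫ x, C * h n x :=
          setIntegral_le_integral ((hhint n).const_mul C) (Eventually.of_forall fun x =>
            mul_nonneg hC0 ((norm_nonneg _).trans (hηh n x)))
      _ ≤ C * (1 / ((n : ℝ) + 1)) := by
          rw [integral_const_mul]
          exact mul_le_mul_of_nonneg_left (hhε n) hC0
      _ ≤ ε := hn.le

end SingularSet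

/-! ### From the flux inequality to the Hardy inequality -/

section Hardy

variable {d : ℕ}

local notation "E" => EuclideanSpace ℝ (Fin d)

variable {Ω D : Set (EuclideanSpace ℝ (Fin d))} {p : ℝ}

theorem fderiv_abs_rpow_apply (hp : 1 < p) {ζ : E → ℝ} (hζ : Differentiable ℝ ζ) (x v : E) :
    fderiv ℝ (fun x => |ζ x| ^ p) x v = p * |ζ x| ^ (p - 2) * ζ x * fderiv ℝ ζ x v := by
  have h := ((hasDerivAt_abs_rpow (ζ x) hp).comp_hasFDerivAt x (hζ x).hasFDerivAt).fderiv
  change fderiv ℝ ((fun y : ℝ => |y| ^ p) ∘ ζ) x v = _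
  rw [h]
  simp

/-- Because `p > 1`, `|ζ|^p` is `C¹` even at zeros of `ζ`; it need not be smoother, which is why
test functions in the flux inequality are only `C¹`. -/
theorem isNonnegTest_abs_rpow (hp : 1 < p) {ζ : E → ℝ} (hζ : ζ ∈ testFunctions D) :
    IsNonnegTest D (fun x => |ζ x| ^ p) := by
  have hp0 : p ≠ 0 := by linarith
  have hsub : Function.support (fun x => |ζ x| ^ p) ⊆ tsupport ζ := fun x hx => by
    refine subset_tsupport ζ fun h0 => hx ?_
    simp [h0, hp0]
  refine ⟨(hζ.1.of_le (by simp)).norm_rpow hp, fun x => by positivity, ?_,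
    hζ.2.2.mono_left (closure_minimal hsub (isClosed_tsupport ζ))⟩
  exact hζ.2.1.mono' hsub

/-- Young's inequality in the form in which it absorbs the gradient of `|z| ^ p`. -/
theorem neg_mul_rpow_mul_le (hp : 1 < p) {z s N M : ℝ} (hN : 0 ≤ N) (hM : 0 ≤ M)
    (hs : |s| ≤ N * M) :
    -(p * |z| ^ (p - 2) * z * s) ≤ M ^ p + (p - 1) * N ^ (p / (p - 1)) * |z| ^ p := by
  have hp0 : 0 < p := by linarith
  have hp1 : 0 < p - 1 := by linarith
  have hz : |z| ^ (p - 2) * |z| = |z| ^ (p - 1) := by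
    rcases eq_or_ne z 0 with rfl | h0
    · simp [Real.zero_rpow hp1.ne']
    · rw [← Real.rpow_add_one (abs_ne_zero.2 h0)]
      ring_nf
  have h1 : -(p * |z| ^ (p - 2) * z * s) ≤ p * (M * (N * |z| ^ (p - 1))) := by
    refine (neg_le_abs _).trans ?_
    rw [abs_mul, abs_mul, abs_mul, abs_of_pos hp0, abs_of_nonneg (by positivity : 0 ≤ |z| ^ (p - 2)),
      mul_assoc p, hz]
    calc p * |z| ^ (p - 1) * |s| ≤ p * |z| ^ (p - 1) * (N * M) :=
          mul_le_mul_of_nonneg_left hs (by positivity)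
      _ = p * (M * (N * |z| ^ (p - 1))) := by ring
  -- Young with exponents `p` and `p' = p / (p - 1)` for the factors `M` and `N |z|^{p-1}`. Here `(p
  -- - 1) p' = p` restores `|z|^p`, and multiplying by `p` gives the constant `p / p' = p - 1`.
  have hY := Real.young_inequality_of_nonneg hM
    (by positivity : 0 ≤ N * |z| ^ (p - 1)) (Real.HolderConjugate.conjExponent hp)
  rw [Real.conjExponent, Real.mul_rpow hN (by positivity), ← Real.rpow_mul (abs_nonneg z),
    mul_div_cancel₀ p hp1.ne'] at hY
  have h2 := mul_le_mul_of_nonneg_left hY hp0.le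
  refine h1.trans (h2.trans_eq ?_)
  field_simp

/-- Common source of both inequalities: only the bound `|V · ∇ζ| ≤ N M` matters. The flux inequality
is tested with `|ζ|^p`, and `neg_mul_rpow_mul_le` absorbs the gradient term pointwise. -/
theorem IsRegularDomain.hardy_inequality {V : E → E} (hΩ : IsRegularDomain Ω D) (hp : 1 < p)
    (hV : ∀ i, IsAbsCont Ω D (fun x => V x i))
    (hflux : ∀ᵐ x ∂(μH[(d : ℝ) - 1] : Measure E), x ∈ frontier Ω \ D →
      ∀ ν, IsOutwardNormalAt Ω x ν → (inner ℝ ν (V x) : ℝ) ≤ 0)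
    {ζ : E → ℝ} (hζ : ζ ∈ testFunctions D) {N M : E → ℝ} (hN : ∀ x, 0 ≤ N x) (hM : ∀ x, 0 ≤ M x)
    (hNc : ContinuousOn N (closure Ω \ D)) (hMc : ContinuousOn M (closure Ω \ D))
    (hM0 : ∀ x ∉ tsupport ζ, M x = 0) (hVNM : ∀ x, |fderiv ℝ ζ x (V x)| ≤ N x * M x) :
    IntegrableOn (fun x => M x ^ p) Ω ∧
    IntegrableOn (fun x => (divergence V x - (p - 1) * N x ^ (p / (p - 1))) * |ζ x| ^ p) Ω ∧
    ∫ x in Ω, M x ^ p ≥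
      ∫ x in Ω, (divergence V x - (p - 1) * N x ^ (p / (p - 1))) * |ζ x| ^ p := by
  have hp0 : 0 < p := by linarith
  have hq0 : 0 ≤ p / (p - 1) := div_nonneg hp0.le (by linarith)
  have hΨ := isNonnegTest_abs_rpow hp hζ
  have hΩo := hΩ.isOpen
  have i1 : IntegrableOn (fun x => M x ^ p) Ω :=
    integrableOn_of_continuousOn_of_eq_zero (hMc.rpow_const fun _ _ => Or.inr hp0.le) hΩo
      hζ.2.1 hζ.2.2 fun x hx => by rw [hM0 x hx, Real.zero_rpow hp0.ne']
  have i2 : IntegrableOn (fun x => (p - 1) * N x ^ (p / (p - 1)) * |ζ x| ^ p) Ω :=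
    integrableOn_of_continuousOn_of_eq_zero
      ((continuousOn_const.mul (hNc.rpow_const fun _ _ => Or.inr hq0)).mul
        hΨ.contDiff.continuous.continuousOn) hΩo hΨ.hasCompactSupport hΨ.disjoint
      fun x hx => by
        rw [image_eq_zero_of_notMem_tsupport (f := fun x => |ζ x| ^ p) hx, mul_zero]
  have i3 := hΨ.integrableOn_divergence_mul hV hΩo
  have i4 := hΨ.integrableOn_fderiv_apply hV hΩo
  have hsplit : ∀ x, (divergence V x - (p - 1) * N x ^ (p / (p - 1))) * |ζ x| ^ p =
      divergence V x * |ζ x| ^ p - (p - 1) * N x ^ (p / (p - 1)) * |ζ x| ^ p := fun x =>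
    sub_mul _ _ _
  simp only [hsplit]
  refine ⟨i1, i3.sub i2, ?_⟩
  have hF : ∫ x in Ω, divergence V x * |ζ x| ^ p ≤
      - ∫ x in Ω, fderiv ℝ (fun x => |ζ x| ^ p) x (V x) := hΩ.fluxIneq hV hflux hΨ
  have hle : ∫ x in Ω, - fderiv ℝ (fun x => |ζ x| ^ p) x (V x) ≤
      ∫ x in Ω, (M x ^ p + (p - 1) * N x ^ (p / (p - 1)) * |ζ x| ^ p) := by
    refine integral_mono i4.neg (i1.add i2) fun x => ?_
    simp only
    rw [fderiv_abs_rpow_apply hp (hζ.1.differentiable (by simp))]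
    exact neg_mul_rpow_mul_le hp (hN x) (hM x) (hVNM x)
  rw [integral_neg, integral_add i1 i2] at hle
  rw [integral_sub i3 i2]
  linarith

theorem continuous_gradient {ζ : E → ℝ} (hζ : ContDiff ℝ 1 ζ) : Continuous (∇ ζ) :=
  (InnerProductSpace.toDual ℝ E).symm.continuous.comp (hζ.continuous_fderiv one_ne_zero)

theorem gradient_eq_zero_of_notMem_tsupport {ζ : E → ℝ} {x : E} (hx : x ∉ tsupport ζ) :
    ∇ ζ x = 0 := by
  rw [gradient, fderiv_eq_zero_of_notMem_tsupport hx, map_zero]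

theorem matVec_apply (B : Matrix (Fin d) (Fin d) ℝ) (v : E) (i : Fin d) :
    matVec B v i = ∑ j, B i j * v j := rfl

theorem inner_matVec_transpose (B : Matrix (Fin d) (Fin d) ℝ) (v w : E) :
    (inner ℝ v (matVec Bᵀ w) : ℝ) = inner ℝ w (matVec B v) := by
  simp only [PiLp.inner_apply, matVec_apply, RCLike.inner_apply, conj_trivial, Finset.sum_mul,
    Matrix.transpose_apply]
  rw [Finset.sum_comm]
  exact Finset.sum_congr rfl fun j _ => Finset.sum_congr rfl fun i _ => by ring

end Hardy

/-- For the matrix inequality, `V · ∇ζ = Q · A∇ζ` and Cauchy–Schwarz gives the factors `|Q|` and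
`|A∇ζ|`. For the directional one, `V · ∇ζ = q (a u · ∇ζ)` already factors exactly, and `div V = u ·
∇(aq)` because `u` is constant. -/
theorem lemmaI1 (d : ℕ) (Ω D : Set (EuclideanSpace ℝ (Fin d))) (hΩ : IsRegularDomain Ω D)
    (p : ℝ) (hp : 1 < p) :
    (∀ (Q : EuclideanSpace ℝ (Fin d) → EuclideanSpace ℝ (Fin d))
        (A : EuclideanSpace ℝ (Fin d) → Matrix (Fin d) (Fin d) ℝ),
      (∀ i, IsAbsCont Ω D (fun x => Q x i)) →
      (∀ i j, IsAbsCont Ω D (fun x => A x i j)) →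
      (∀ᵐ x ∂(μH[(d : ℝ) - 1] : Measure (EuclideanSpace ℝ (Fin d))), x ∈ frontier Ω \ D →
        ∀ ν, IsOutwardNormalAt Ω x ν → (inner ℝ ν (matVec (A x)ᵀ (Q x)) : ℝ) ≤ 0) →
      ∀ ζ ∈ testFunctions D,
        IntegrableOn (fun x => ‖matVec (A x) (∇ ζ x)‖ ^ p) Ω ∧
        IntegrableOn (fun x => (divergence (fun y => matVec (A y)ᵀ (Q y)) x
          - (p - 1) * ‖Q x‖ ^ (p / (p - 1))) * |ζ x| ^ p) Ω ∧
        ∫ x in Ω, ‖matVec (A x) (∇ ζ x)‖ ^ p ≥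
          ∫ x in Ω, (divergence (fun y => matVec (A y)ᵀ (Q y)) x
            - (p - 1) * ‖Q x‖ ^ (p / (p - 1))) * |ζ x| ^ p) ∧
    (∀ (a q : EuclideanSpace ℝ (Fin d) → ℝ) (u : EuclideanSpace ℝ (Fin d)),
      IsAbsCont Ω D a → IsAbsCont Ω D q → ‖u‖ = 1 →
      (∀ᵐ x ∂(μH[(d : ℝ) - 1] : Measure (EuclideanSpace ℝ (Fin d))), x ∈ frontier Ω \ D →
        ∀ ν, IsOutwardNormalAt Ω x ν → a x * q x * (inner ℝ u ν : ℝ) ≤ 0) →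
      ∀ ζ ∈ testFunctions D,
        IntegrableOn (fun x => |a x * (inner ℝ u (∇ ζ x) : ℝ)| ^ p) Ω ∧
        IntegrableOn (fun x => ((∑ i, u i * partialDeriv i (fun y => a y * q y) x)
          - (p - 1) * |q x| ^ (p / (p - 1))) * |ζ x| ^ p) Ω ∧
        ∫ x in Ω, |a x * (inner ℝ u (∇ ζ x) : ℝ)| ^ p ≥
          ∫ x in Ω, ((∑ i, u i * partialDeriv i (fun y => a y * q y) x)
            - (p - 1) * |q x| ^ (p / (p - 1))) * |ζ x| ^ p) := by
  have hΩo := hΩ.isOpen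
  have hD := hΩ.subset_frontier
  refine ⟨fun Q A hQ hA hflux ζ hζ => ?_, fun a q u ha hq hu hflux ζ hζ => ?_⟩
  · have hζc : ContDiff ℝ 1 ζ := hζ.1.of_le (by simp)
    refine hΩ.hardy_inequality hp (V := fun y => matVec (A y)ᵀ (Q y)) (fun i => ?_) hflux hζ
      (N := fun x => ‖Q x‖) (M := fun x => ‖matVec (A x) (∇ ζ x)‖) (fun x => norm_nonneg _)
      (fun x => norm_nonneg _) ?_ ?_ (fun x hx => ?_) fun x => ?_
    · simp only [matVec_apply, Matrix.transpose_apply]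
      exact isAbsCont_sum _ (fun j _ => (hA j i).mul (hQ j) hΩo hD) hΩo hD
    · exact (continuousOn_of_components fun i => (hQ i).continuousOn).norm
    · refine (continuousOn_of_components fun i => ?_).norm
      simp only [matVec_apply]
      refine continuousOn_finsetSum _ fun j _ => (hA i j).continuousOn.mul ?_
      exact ((PiLp.continuous_apply 2 _ j).comp (continuous_gradient hζc)).continuousOn
    · simp [gradient_eq_zero_of_notMem_tsupport hx, matVec]
    · rw [← inner_gradient, inner_matVec_transpose]
      exact abs_real_inner_le_norm _ _
  · have hζc : ContDiff ℝ 1 ζ := hζ.1.of_le (by simp)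
    have hdiv : ∀ x, divergence (fun y => (a y * q y) • u) x =
        ∑ i, u i * partialDeriv i (fun y => a y * q y) x := by
      intro x
      refine Finset.sum_congr rfl fun i _ => ?_
      simp only [partialDeriv, lineDeriv, PiLp.smul_apply, smul_eq_mul]
      rw [deriv_mul_const_field, mul_comm]
    have h := hΩ.hardy_inequality hp (V := fun y => (a y * q y) • u) (fun i => ?_) ?_ hζ
      (N := fun x => |q x|) (M := fun x => |a x * (inner ℝ u (∇ ζ x) : ℝ)|)
      (fun x => abs_nonneg _) (fun x => abs_nonneg _) hq.continuousOn.abs ?_ (fun x hx => ?_)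
      fun x => ?_
    · simpa only [hdiv] using h
    · simp only [PiLp.smul_apply, smul_eq_mul]
      exact (ha.mul hq hΩo hD).mul (isAbsCont_const _) hΩo hD
    · filter_upwards [hflux] with x hx hxf ν hν
      rw [inner_smul_right, real_inner_comm]
      exact hx hxf ν hν
    · exact (ha.continuousOn.mul
        (continuous_const.inner (continuous_gradient hζc)).continuousOn).abs
    · simp [gradient_eq_zero_of_notMem_tsupport hx]
    · rw [← inner_gradient, inner_smul_right, real_inner_comm, ← abs_mul]
      exact le_of_eq (by ring_nf)
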